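/- Identify the Heisenberg group $\mathbb H$ with $\mathbb R^3$ with the group law $(x,y,z)(x',y',z')=(x+x',\,y+y',\,z+z'+\tfrac12(xy'-x'y))$, and put $X=\partial_x-\tfrac y2\partial_z$, $Y=\partial_y+\tfrac x2\partial_z$. The perimeter of a measurable set $G\subset\mathbb H$ in an open set $U$ is $$P(G;U)=\sup\Big\{\int_G (X\psi_1+Y\psi_2)\,d\mathcal L^3:\ \psi_1,\psi_2\in C_c^\infty(U),\ \psi_1^2+\psi_2^2\le1\Big\},$$ and $G$ is a perimeter minimizer in $U$ if $P(G;U)\le P(F;U)$ for every measurable $F$ whose symmetric difference with $G$ is relatively compact in $U$. For $f:\mathbb R^2\to\mathbb R$ let $\Gamma_f=\{(0,y,t)(f(y,t),0,0):(y,t)\in\mathbb R^2\}$ be its intrinsic graph and $G_f=\{(0,y,t)(\xi,0,0):(y,t)\in\mathbb R^2,\ \xi\le f(y,t)\}$ its subgraph; $\Gamma_f$ is called area minimizing in $U$ if $G_f$ is a perimeter minimizer in $U$. An intrinsic plane is a coset of a two-dimensional Lie subgroup of $\mathbb H$. For $f\in W^{1,1}_{\rm loc}(\mathbb R^2)$ let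 $\nabla^f f=\partial_yf+f\,\partial_tf$ (weak derivatives) and $\mathscr A_f(E)=\int_E\sqrt{1+(\nabla^ff)^2}\,d\mathcal L^2$. Such an $f$ is stable if, for all $\varphi\in C^\infty_c(\mathbb R^2)$, the function $\epsilon\mapsto\mathscr A_{f+\epsilon\varphi}(\operatorname{spt}\varphi)$ is finite near $0$ and twice differentiable at $0$, with first derivative $0$ and second derivative $\ge0$ there. **Theorem.** Define $f:\mathbb R^2\to\mathbb R$ by $$f(y,t)=\begin{cases}0,& t\le0,\\ 2t/y,& 0<t\le y^2/2,\\ y,& t>y^2/2.\end{cases}$$ Then: (i) $f$ is continuous, $f\in W^{1,p}_{\rm loc}(\mathbb R^2)$ for all $1\le p<3$, and $f$ is locally Lipschitz on $\mathbb R^2\setminus\{0\}$. (ii) $\nabla^ff\in L^\infty(\mathbb R^2)$, and $\nabla^ff$ agrees almost everywhere with a function that is continuous on $\mathbb R^2\setminus\{0\}$. (iii) $f$ is stable, but $\Gamma_f$ is not an intrinsic plane. (iv) $\Gamma_f=\Gamma_1\cup\Gamma_2\cup\Gamma_3$, where $\Gamma_1=\{(0,y,z):z\le0,\ y\in\mathbb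 R\}$, $\Gamma_2=\{(x,y,0):0\le x\le y\}\cup\{(x,y,0):y\le x\le0\}$, $\Gamma_3=\{(x,y,z):x=y,\ z\ge0\}$; and $\Gamma_f$ is a cone: $\delta_\lambda(\Gamma_f)=\Gamma_f$ for all $\lambda>0$, where $\delta_\lambda(x,y,z)=(\lambda x,\lambda y,\lambda^2z)$. (v) Every $p\in\Gamma_f\setminus\{0\}$ has an open neighbourhood $U$ in $\mathbb H$ such that $P(G_f;U)<\infty$ and $\Gamma_f$ is area minimizing in $U$. -/

import Mathlib

open MeasureTheory Set Filter Topology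
open scoped ENNReal

noncomputable section

/-! ### The Heisenberg group in exponential coordinates -/

/-- Points of the first Heisenberg group, with coordinates `(x, y, z)`. The topology, the smooth
structure and the Lebesgue measure are those of `ℝ³`; the group law is `heisMul`. -/
abbrev Heis : Type := ℝ × ℝ × ℝ

/-- The group law `(x,y,z)(x',y',z') = (x+x', y+y', z+z'+(xy'-x'y)/2)`. -/
def heisMul (p q : Heis) : Heis :=
  (p.1 + q.1, p.2.1 + q.2.1, p.2.2 + q.2.2 + (1 / 2) * (p.1 * q.2.1 - q.1 * p.2.1))

/-- The inverse for `heisMul`, whose neutral element is `0 = (0, 0, 0)`. -/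
def heisInv (p : Heis) : Heis := (-p.1, -p.2.1, -p.2.2)

/-- `H` is a subgroup of the Heisenberg group. (Mathlib's `Subgroup` would refer to the
componentwise product of `ℝ × ℝ × ℝ`, not to `heisMul`.) -/
structure IsHeisSubgroup (H : Set Heis) : Prop where
  zero_mem : (0 : Heis) ∈ H
  mul_mem : ∀ p ∈ H, ∀ q ∈ H, heisMul p q ∈ H
  inv_mem : ∀ p ∈ H, heisInv p ∈ H

/-- The dilation `δ_l (x,y,z) = (l x, l y, l² z)`. -/
def heisDilation (l : ℝ) (p : Heis) : Heis := (l * p.1, l * p.2.1, l ^ 2 * p.2.2)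

/-- `S` is an intrinsic plane: a coset `p H` of a two-dimensional Lie (that is, closed) subgroup
`H` of the Heisenberg group. In these coordinates the exponential map is the identity, so the
Lie algebra of `H` is the set of all `v` with `s • v ∈ H` for every real `s`. Such a subgroup
contains the centre, so that it is normal and left and right cosets agree. -/
def IsIntrinsicPlane (S : Set Heis) : Prop :=
  ∃ H : Set Heis, IsHeisSubgroup H ∧ IsClosed H ∧
    (∃ L : Submodule ℝ Heis, Module.finrank ℝ L = 2 ∧
      ∀ v : Heis, v ∈ L ↔ ∀ s : ℝ, s • v ∈ H) ∧
    ∃ p : Heis, S = heisMul p '' H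

/-! ### Sub-Riemannian perimeter -/

/-- `φ ∈ C^∞_c(Ω)`. -/
structure IsTestFunction {E : Type*} [NormedAddCommGroup E] [NormedSpace ℝ E]
    (Ω : Set E) (φ : E → ℝ) : Prop where
  contDiff : ContDiff ℝ ((⊤ : ℕ∞) : WithTop ℕ∞) φ
  hasCompactSupport : HasCompactSupport φ
  tsupport_subset : tsupport φ ⊆ Ω

/-- The derivative along the vector field `X = ∂_x - (y/2) ∂_z`. -/
def heisX (ψ : Heis → ℝ) (p : Heis) : ℝ := fderiv ℝ ψ p (1, 0, -(p.2.1 / 2))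

/-- The derivative along the vector field `Y = ∂_y + (x/2) ∂_z`. -/
def heisY (ψ : Heis → ℝ) (p : Heis) : ℝ := fderiv ℝ ψ p (0, 1, p.1 / 2)

/-- The sub-Riemannian perimeter of `G` in `Ω`. The supremum of the integrals is non-negative
(take `ψ₁ = ψ₂ = 0`), so nothing is lost by truncating each of them at `0`. -/
def srPerimeter (G Ω : Set Heis) : ℝ≥0∞ :=
  ⨆ (ψ₁ : Heis → ℝ) (ψ₂ : Heis → ℝ) (_ : IsTestFunction Ω ψ₁) (_ : IsTestFunction Ω ψ₂)
    (_ : ∀ p, ψ₁ p ^ 2 + ψ₂ p ^ 2 ≤ 1), ENNReal.ofReal (∫ p in G, (heisX ψ₁ p + heisY ψ₂ p))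

/-- `G` is a perimeter minimizer in `Ω`: its perimeter in `Ω` is at most that of every (Lebesgue)
measurable `F` whose symmetric difference with `G` is relatively compact in `Ω`. -/
def IsPerimeterMinimizer (G Ω : Set Heis) : Prop :=
  NullMeasurableSet G ∧
  ∀ F : Set Heis, NullMeasurableSet F →
    IsCompact (closure ((G \ F) ∪ (F \ G))) → closure ((G \ F) ∪ (F \ G)) ⊆ Ω →
    srPerimeter G Ω ≤ srPerimeter F Ω

/-! ### Intrinsic graphs -/

/-- The intrinsic graph `Γ_f = {(0,y,t)(f(y,t),0,0) : (y,t) ∈ ω}`. -/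
def intrinsicGraph (ω : Set (ℝ × ℝ)) (f : ℝ × ℝ → ℝ) : Set Heis :=
  {q | ∃ y t : ℝ, (y, t) ∈ ω ∧ q = heisMul (0, y, t) (f (y, t), 0, 0)}

/-- The subgraph `G_f = {(0,y,t)(ξ,0,0) : (y,t) ∈ ω, ξ ≤ f(y,t)}`. -/
def intrinsicSubgraph (ω : Set (ℝ × ℝ)) (f : ℝ × ℝ → ℝ) : Set Heis :=
  {q | ∃ y t ξ : ℝ, (y, t) ∈ ω ∧ ξ ≤ f (y, t) ∧ q = heisMul (0, y, t) (ξ, 0, 0)}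

/-! ### Sobolev functions on open subsets of the `(y, t)`-plane -/

/-- `g` is the weak (distributional) derivative of `f` in the constant direction `v` on the
open set `ω`, both functions being locally integrable on `ω`. -/
def HasWeakDeriv (ω : Set (ℝ × ℝ)) (v : ℝ × ℝ) (f g : ℝ × ℝ → ℝ) : Prop :=
  LocallyIntegrableOn f ω ∧ LocallyIntegrableOn g ω ∧
  ∀ φ : ℝ × ℝ → ℝ, IsTestFunction ω φ →
    ∫ p, f p * fderiv ℝ φ p v = -∫ p, g p * φ p

open Classical in
/-- The weak derivative of `f` in the direction `v` on `ω`, determined up to null sets of `ω`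
(and `0` if `f` has no weak derivative in this direction). -/
def weakDeriv (ω : Set (ℝ × ℝ)) (v : ℝ × ℝ) (f : ℝ × ℝ → ℝ) : ℝ × ℝ → ℝ :=
  if h : ∃ g, HasWeakDeriv ω v f g then h.choose else 0

/-- `f ∈ W^{1,p}_loc(ω)`: `f` and its weak partial derivatives are in `L^p(K)` for each compact
`K ⊆ ω`. -/
def MemW1pLoc (ω : Set (ℝ × ℝ)) (p : ℝ≥0∞) (f : ℝ × ℝ → ℝ) : Prop :=
  ∃ fy ft : ℝ × ℝ → ℝ, HasWeakDeriv ω (1, 0) f fy ∧ HasWeakDeriv ω (0, 1) f ft ∧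
    ∀ K : Set (ℝ × ℝ), IsCompact K → K ⊆ ω →
      MemLp f p (volume.restrict K) ∧ MemLp fy p (volume.restrict K) ∧
        MemLp ft p (volume.restrict K)

/-! ### Intrinsic gradient, area functional, stability -/

/-- The intrinsic gradient `∇^f f = ∂_y f + f ∂_t f`, with weak derivatives. -/
def intrinsicGradient (ω : Set (ℝ × ℝ)) (f : ℝ × ℝ → ℝ) (p : ℝ × ℝ) : ℝ :=
  weakDeriv ω (1, 0) f p + f p * weakDeriv ω (0, 1) f p

/-- The graph area functional `A_f(E) = ∫_E √(1 + (∇^f f)²)`. -/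
def graphArea (ω : Set (ℝ × ℝ)) (f : ℝ × ℝ → ℝ) (E : Set (ℝ × ℝ)) : ℝ≥0∞ :=
  ∫⁻ p in E, ENNReal.ofReal (√(1 + intrinsicGradient ω f p ^ 2))

/-- `ε ↦ A_{f+εφ}(spt φ)`. -/
def areaAlong (ω : Set (ℝ × ℝ)) (f φ : ℝ × ℝ → ℝ) (ε : ℝ) : ℝ≥0∞ :=
  graphArea ω (fun p => f p + ε * φ p) (tsupport φ)

/-- `f` is stationary: `f ∈ W^{1,1}_loc(ω)` and, for each `φ ∈ C^∞_c(ω)`, the area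
`A_{f+εφ}(spt φ)` is finite for small `ε` and its derivative at `ε = 0` exists and vanishes. -/
def IsStationaryGraph (ω : Set (ℝ × ℝ)) (f : ℝ × ℝ → ℝ) : Prop :=
  MemW1pLoc ω 1 f ∧
  ∀ φ : ℝ × ℝ → ℝ, IsTestFunction ω φ →
    (∀ᶠ ε in 𝓝 (0 : ℝ), areaAlong ω f φ ε < ∞) ∧
    HasDerivAt (fun ε => (areaAlong ω f φ ε).toReal) 0 0

/-- `f` is stable: it is stationary and, for each `φ ∈ C^∞_c(ω)`, the second derivative of
`A_{f+εφ}(spt φ)` at `ε = 0` exists and is non-negative. -/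
def IsStableGraph (ω : Set (ℝ × ℝ)) (f : ℝ × ℝ → ℝ) : Prop :=
  IsStationaryGraph ω f ∧
  ∀ φ : ℝ × ℝ → ℝ, IsTestFunction ω φ →
    ∃ (A' : ℝ → ℝ) (c : ℝ), 0 ≤ c ∧
      (∀ᶠ ε in 𝓝 (0 : ℝ), HasDerivAt (fun e => (areaAlong ω f φ e).toReal) (A' ε) ε) ∧
      HasDerivAt A' c 0

/-! ### The function -/

open Classical in
/-- `f(y,t) = 0` for `t ≤ 0`, `2t/y` for `0 < t ≤ y²/2`, and `y` for `t > y²/2`. -/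
def coneFun (p : ℝ × ℝ) : ℝ :=
  if p.2 ≤ 0 then 0 else if p.2 ≤ p.1 ^ 2 / 2 then 2 * p.2 / p.1 else p.1

end

/-! Write `f = y g`, where `g = coneGrad` is `2t/y²` truncated to `[0, 1]`. Off the kinks `t = 0`
and `t = y²/2` one has `∂_y g + f ∂_t g = 0`: `g` is constant along the characteristics of `∂_y + f
∂_t`. Hence `∇^f f = g`, which is bounded, and continuous off the origin. The only unbounded first
derivative of `f` is `∂_t f = 2/y`, living on a sector whose slice at `y` has length `y²/2`; this is
where `p < 3` comes from. Integration by parts survives the kinks and the origin, since almost every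
coordinate line misses the origin and meets the kinks in at most two points.

Stability: the intrinsic gradient of `f + εφ` is `g + ε a + ε² φ φ_t` with `a = φ_y + f φ_t + f_t φ`
in `L²`. Let `u(s) = s/√(1+s²)` and `k = u'`. Since `u(g)` is transported along characteristics like
`g`, the first variation vanishes. With `w = ∂_t u(g) = k(g) g_t`, the second variation is `∫ k(g)
a² - w φ²`. Weakly `w_y + (f w)_t = 0` (`integral_coneSlopeSnd_mul_jacobian`); testing this with `y
φ²` produces a null integral, and subtracting it completes the square: on the sector the integrand
becomes `k(g) (φ_y + f φ_t)²`, and elsewhere `w = 0`.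

Minimality: in the measure-preserving coordinates `coneChart` the subgraph is `s ≤ 0`, and the
Gauss–Green formula holds with normal proportional to `(1, -g)`. A smooth divergence-free horizontal
field of length at most `1` that extends the unit normal is a calibration. On the graph `x = y g`,
so where `y ≠ 0` the field `(1, -x/y)/√(1+(x/y)²)` works, even across the creases. At the remaining
points other than the origin, `g` is locally `0` or `1` and a constant field works. -/

/-! ### Integration by parts for piecewise differentiable functions on the plane -/

/-- The points of the plane off the `y`-axis and off the parabola `t = y² / 2`. -/
def IsRegularPoint (p : ℝ × ℝ) : Prop := p.2 ≠ 0 ∧ p.2 ≠ p.1 ^ 2 / 2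

lemma isClosedEmbedding_prodMkRight {X Y : Type*} [TopologicalSpace X] [TopologicalSpace Y]
    [T1Space Y] (t : Y) : IsClosedEmbedding fun y : X => (y, t) := by
  refine ⟨isEmbedding_prodMkLeft t, ?_⟩
  have : range (fun y : X => (y, t)) = Prod.snd ⁻¹' {t} := by ext ⟨a, b⟩; simp [eq_comm]
  rw [this]
  exact isClosed_singleton.preimage continuous_snd

lemma isClosedEmbedding_prodMkLeft {X Y : Type*} [TopologicalSpace X] [TopologicalSpace Y]
    [T1Space X] (x : X) : IsClosedEmbedding fun y : Y => (x, y) := by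
  refine ⟨isEmbedding_prodMkRight x, ?_⟩
  have : range (fun y : Y => (x, y)) = Prod.fst ⁻¹' {x} := by ext ⟨a, b⟩; simp [eq_comm]
  rw [this]
  exact isClosed_singleton.preimage continuous_fst

/-- `G'` is the partial derivative of `G` in the first variable at all regular points. -/
def HasPartialFst (G G' : ℝ × ℝ → ℝ) : Prop :=
  ∀ p, IsRegularPoint p → HasDerivAt (fun y => G (y, p.2)) (G' p) p.1

/-- `G'` is the partial derivative of `G` in the second variable at all regular points. -/
def HasPartialSnd (G G' : ℝ × ℝ → ℝ) : Prop :=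
  ∀ p, IsRegularPoint p → HasDerivAt (fun t => G (p.1, t)) (G' p) p.2

lemma integral_eq_zero_of_hasDerivAt_off_countable {h h' : ℝ → ℝ} {s : Set ℝ}
    (hs : s.Countable) (hc : Continuous h) (hsupp : HasCompactSupport h)
    (hd : ∀ x, x ∉ s → HasDerivAt h (h' x) x) (hi : Integrable h') : ∫ x, h' x = 0 := by
  have h1 := intervalIntegral_tendsto_integral hi (tendsto_neg_atTop_atBot.comp
    tendsto_natCast_atTop_atTop) (tendsto_natCast_atTop_atTop (R := ℝ))
  obtain ⟨R, hR⟩ := hsupp.isCompact.isBounded.subset_closedBall 0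
  refine tendsto_nhds_unique h1 (tendsto_const_nhds.congr' ?_)
  filter_upwards [(tendsto_natCast_atTop_atTop (R := ℝ)).eventually_gt_atTop R] with n hn
  have hz : ∀ x : ℝ, R < |x| → h x = 0 := fun x hx => by
    by_contra h0
    have := hR (subset_tsupport _ h0)
    simp at this
    linarith
  rw [integral_eq_of_hasDerivAt_off_countable h h' hs hc.continuousOn
    (fun x hx => hd x hx.2) hi.intervalIntegrable]
  have hn' : R < |(n : ℝ)| := lt_of_lt_of_le hn (le_abs_self _)
  simp only [Function.comp]
  rw [hz _ hn', hz (-(n : ℝ)) (by rwa [abs_neg])]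
  simp

lemma continuous_slice_fst {G : ℝ × ℝ → ℝ} (hG : ContinuousOn G {(0 : ℝ × ℝ)}ᶜ) {t : ℝ}
    (ht : t ≠ 0) : Continuous fun y => G (y, t) :=
  hG.comp_continuous (by fun_prop) fun y => by simp [ht]

lemma continuous_slice_snd {G : ℝ × ℝ → ℝ} (hG : ContinuousOn G {(0 : ℝ × ℝ)}ᶜ) {y : ℝ}
    (hy : y ≠ 0) : Continuous fun t => G (y, t) :=
  hG.comp_continuous (by fun_prop) fun t => by simp [hy]

/-- Fubini reduces this to the lines `t = const ≠ 0`. These avoid the origin, where `G` may be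
discontinuous, and contain at most two irregular points, which the fundamental theorem of calculus
tolerates. -/
lemma integral_partialFst_eq_zero {G G' : ℝ × ℝ → ℝ} (hG : ContinuousOn G {(0 : ℝ × ℝ)}ᶜ)
    (hsupp : HasCompactSupport G) (hd : HasPartialFst G G') (hi : Integrable G') :
    ∫ p, G' p = 0 := by
  rw [Measure.volume_eq_prod] at hi ⊢
  rw [integral_prod_symm _ hi]
  refine integral_eq_zero_of_ae ?_
  have h0 : ∀ᵐ t : ℝ, t ≠ 0 := by simp [ae_iff]
  filter_upwards [h0, hi.prod_left_ae] with t ht hit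
  -- The line meets the parabola where `y² = 2t`. For `t < 0` the root takes its default value `0`,
  -- which only adds a harmless exceptional point.
  refine integral_eq_zero_of_hasDerivAt_off_countable (s := {√(2 * t), -√(2 * t)})
    (h := fun y => G (y, t))
    (by simp) (continuous_slice_fst hG ht)
    (hsupp.comp_isClosedEmbedding (isClosedEmbedding_prodMkRight t)) (fun y hy => ?_) hit
  refine hd (y, t) ⟨ht, fun h => hy ?_⟩
  simp only at h
  have : 2 * t = y ^ 2 := by rw [h]; ring
  rw [this, Real.sqrt_sq_eq_abs]
  rcases abs_choice y with h | h <;> simp [h]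

lemma integral_partialSnd_eq_zero {G G' : ℝ × ℝ → ℝ} (hG : ContinuousOn G {(0 : ℝ × ℝ)}ᶜ)
    (hsupp : HasCompactSupport G) (hd : HasPartialSnd G G') (hi : Integrable G') :
    ∫ p, G' p = 0 := by
  rw [Measure.volume_eq_prod] at hi ⊢
  rw [integral_prod _ hi]
  refine integral_eq_zero_of_ae ?_
  have h0 : ∀ᵐ t : ℝ, t ≠ 0 := by simp [ae_iff]
  filter_upwards [h0, hi.prod_right_ae] with y hy hiy
  refine integral_eq_zero_of_hasDerivAt_off_countable (s := {0, y ^ 2 / 2})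
    (h := fun t => G (y, t))
    (by simp) (continuous_slice_snd hG hy)
    (hsupp.comp_isClosedEmbedding (isClosedEmbedding_prodMkLeft y)) (fun t ht => ?_) hiy
  simp only [mem_insert_iff, mem_singleton_iff, not_or] at ht
  exact hd (y, t) ht

lemma hasDerivAt_slice_fst {φ : ℝ × ℝ → ℝ} {p : ℝ × ℝ} (h : DifferentiableAt ℝ φ p) :
    HasDerivAt (fun y => φ (y, p.2)) (fderiv ℝ φ p (1, 0)) p.1 :=
  h.hasFDerivAt.comp_hasDerivAt (f := fun y : ℝ => (y, p.2)) p.1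
    ((hasDerivAt_id p.1).prodMk (hasDerivAt_const _ _))

lemma hasDerivAt_slice_snd {φ : ℝ × ℝ → ℝ} {p : ℝ × ℝ} (h : DifferentiableAt ℝ φ p) :
    HasDerivAt (fun t => φ (p.1, t)) (fderiv ℝ φ p (0, 1)) p.2 :=
  h.hasFDerivAt.comp_hasDerivAt (f := fun t : ℝ => (p.1, t)) p.2
    ((hasDerivAt_const _ _).prodMk (hasDerivAt_id p.2))

lemma IsTestFunction.differentiable {E : Type*} [NormedAddCommGroup E] [NormedSpace ℝ E]
    {Ω : Set E} {φ : E → ℝ} (h : IsTestFunction Ω φ) : Differentiable ℝ φ :=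
  h.contDiff.differentiable (by simp)

lemma IsTestFunction.continuous {E : Type*} [NormedAddCommGroup E] [NormedSpace ℝ E]
    {Ω : Set E} {φ : E → ℝ} (h : IsTestFunction Ω φ) : Continuous φ := h.contDiff.continuous

lemma IsTestFunction.fderiv_apply {E : Type*} [NormedAddCommGroup E] [NormedSpace ℝ E]
    {Ω : Set E} {φ : E → ℝ} (h : IsTestFunction Ω φ) (v : E) :
    IsTestFunction Ω fun p => fderiv ℝ φ p v where
  contDiff := (h.contDiff.fderiv_right (m := ((⊤ : ℕ∞) : WithTop ℕ∞)) (by simp)).clm_apply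
    contDiff_const
  hasCompactSupport := h.hasCompactSupport.fderiv_apply (𝕜 := ℝ) v
  tsupport_subset := (tsupport_fderiv_apply_subset ℝ v).trans h.tsupport_subset

lemma IsTestFunction.mul_contDiff {E : Type*} [NormedAddCommGroup E] [NormedSpace ℝ E]
    {Ω : Set E} {φ ψ : E → ℝ} (h : IsTestFunction Ω φ)
    (hψ : ContDiff ℝ ((⊤ : ℕ∞) : WithTop ℕ∞) ψ) : IsTestFunction Ω fun p => ψ p * φ p where
  contDiff := hψ.mul h.contDiff
  hasCompactSupport := h.hasCompactSupport.mul_left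
  tsupport_subset := (tsupport_mul_subset_right (f := ψ) (g := φ)).trans h.tsupport_subset

lemma MeasureTheory.LocallyIntegrable.integrable_mul_test {F φ : ℝ × ℝ → ℝ}
    (hF : LocallyIntegrable F) (hc : Continuous φ) (hs : HasCompactSupport φ) : Integrable fun p => F p * φ p := by
  simpa [mul_comm] using hF.integrable_smul_left_of_hasCompactSupport hc hs

lemma integral_partialFst_mul_test {F F' φ : ℝ × ℝ → ℝ} {Ω : Set (ℝ × ℝ)}
    (hc : ContinuousOn F {(0 : ℝ × ℝ)}ᶜ) (hd : HasPartialFst F F') (hF : LocallyIntegrable F)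
    (hF' : LocallyIntegrable F') (hφ : IsTestFunction Ω φ) :
    ∫ p, F p * fderiv ℝ φ p (1, 0) = -∫ p, F' p * φ p := by
  have i1 := hF.integrable_mul_test (hφ.fderiv_apply (1, 0)).continuous
    (hφ.fderiv_apply (1, 0)).hasCompactSupport
  have i2 := hF'.integrable_mul_test hφ.continuous hφ.hasCompactSupport
  have := integral_partialFst_eq_zero (G := fun p => F p * φ p)
    (G' := fun p => F' p * φ p + F p * fderiv ℝ φ p (1, 0))
    (hc.mul hφ.continuous.continuousOn) hφ.hasCompactSupport.mul_left
    (fun p hp => (hd p hp).mul (hasDerivAt_slice_fst hφ.differentiable.differentiableAt))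
    (i2.add i1)
  rw [integral_add i2 i1] at this
  linarith

lemma integral_partialSnd_mul_test {F F' φ : ℝ × ℝ → ℝ} {Ω : Set (ℝ × ℝ)}
    (hc : ContinuousOn F {(0 : ℝ × ℝ)}ᶜ) (hd : HasPartialSnd F F') (hF : LocallyIntegrable F)
    (hF' : LocallyIntegrable F') (hφ : IsTestFunction Ω φ) :
    ∫ p, F p * fderiv ℝ φ p (0, 1) = -∫ p, F' p * φ p := by
  have i1 := hF.integrable_mul_test (hφ.fderiv_apply (0, 1)).continuous
    (hφ.fderiv_apply (0, 1)).hasCompactSupport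
  have i2 := hF'.integrable_mul_test hφ.continuous hφ.hasCompactSupport
  have := integral_partialSnd_eq_zero (G := fun p => F p * φ p)
    (G' := fun p => F' p * φ p + F p * fderiv ℝ φ p (0, 1))
    (hc.mul hφ.continuous.continuousOn) hφ.hasCompactSupport.mul_left
    (fun p hp => (hd p hp).mul (hasDerivAt_slice_snd hφ.differentiable.differentiableAt))
    (i2.add i1)
  rw [integral_add i2 i1] at this
  linarith

lemma HasWeakDeriv.of_partialFst {F F' : ℝ × ℝ → ℝ}
    (hc : ContinuousOn F {(0 : ℝ × ℝ)}ᶜ) (hd : HasPartialFst F F') (hF : LocallyIntegrable F)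
    (hF' : LocallyIntegrable F') : HasWeakDeriv univ (1, 0) F F' :=
  ⟨locallyIntegrableOn_univ.2 hF, locallyIntegrableOn_univ.2 hF', fun _ hφ =>
    integral_partialFst_mul_test hc hd hF hF' hφ⟩

lemma HasWeakDeriv.of_partialSnd {F F' : ℝ × ℝ → ℝ}
    (hc : ContinuousOn F {(0 : ℝ × ℝ)}ᶜ) (hd : HasPartialSnd F F') (hF : LocallyIntegrable F)
    (hF' : LocallyIntegrable F') : HasWeakDeriv univ (0, 1) F F' :=
  ⟨locallyIntegrableOn_univ.2 hF, locallyIntegrableOn_univ.2 hF', fun _ hφ =>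
    integral_partialSnd_mul_test hc hd hF hF' hφ⟩

/-- Uniqueness is what allows `weakDeriv`, an arbitrary choice, to be replaced by an explicit
derivative. -/
lemma HasWeakDeriv.ae_eq {v : ℝ × ℝ} {F G G' : ℝ × ℝ → ℝ} (h : HasWeakDeriv univ v F G)
    (h' : HasWeakDeriv univ v F G') : G =ᵐ[volume] G' := by
  refine ae_eq_of_integral_contDiff_smul_eq (locallyIntegrableOn_univ.1 h.2.1)
    (locallyIntegrableOn_univ.1 h'.2.1) fun φ hφ hs => ?_
  have h1 := h.2.2 φ ⟨hφ, hs, subset_univ _⟩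
  rw [h'.2.2 φ ⟨hφ, hs, subset_univ _⟩, neg_inj] at h1
  simpa [mul_comm] using h1.symm

lemma HasWeakDeriv.weakDeriv_ae_eq {v : ℝ × ℝ} {F G : ℝ × ℝ → ℝ}
    (h : HasWeakDeriv univ v F G) : weakDeriv univ v F =ᵐ[volume] G := by
  have hex : ∃ g, HasWeakDeriv univ v F g := ⟨G, h⟩
  rw [weakDeriv, dif_pos hex]
  exact hex.choose_spec.ae_eq h

lemma intrinsicGradient_ae_eq {F Fy Ft : ℝ × ℝ → ℝ} (hy : HasWeakDeriv univ (1, 0) F Fy)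
    (ht : HasWeakDeriv univ (0, 1) F Ft) :
    intrinsicGradient univ F =ᵐ[volume] fun p => Fy p + F p * Ft p := by
  filter_upwards [hy.weakDeriv_ae_eq, ht.weakDeriv_ae_eq] with p h1 h2
  rw [intrinsicGradient, h1, h2]

/-! ### The cone function and its derivatives -/

/-- The intrinsic gradient of `coneFun`: it is `0` for `t ≤ 0`, `2t/y²` for `0 < t ≤ y²/2` and
`1` for `t > y²/2`. -/
noncomputable def coneGrad (p : ℝ × ℝ) : ℝ :=
  max p.2 0 / (max (max p.2 0) (p.1 ^ 2 / 2) + max (-p.2) 0)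

lemma coneGrad_of_nonpos {p : ℝ × ℝ} (h : p.2 ≤ 0) : coneGrad p = 0 := by
  simp [coneGrad, max_eq_right h]

lemma coneGrad_of_mem_sector {p : ℝ × ℝ} (h : 0 < p.2) (h' : p.2 ≤ p.1 ^ 2 / 2) :
    coneGrad p = 2 * p.2 / p.1 ^ 2 := by
  have h0 : p.1 ≠ 0 := fun hy => by rw [hy] at h'; norm_num at h'; linarith
  rw [coneGrad, max_eq_left h.le, max_eq_right h', max_eq_right (by linarith)]
  field_simp
  simp

lemma coneGrad_of_gt {p : ℝ × ℝ} (h : p.1 ^ 2 / 2 < p.2) : coneGrad p = 1 := by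
  have h0 : 0 < p.2 := lt_of_le_of_lt (by positivity) h
  rw [coneGrad, max_eq_left h0.le, max_eq_left h.le, max_eq_right (by linarith)]
  simp [h0.ne']

lemma coneFun_eq (p : ℝ × ℝ) : coneFun p = p.1 * coneGrad p := by
  rw [coneFun]
  split_ifs with h1 h2
  · simp [coneGrad_of_nonpos h1]
  · rw [coneGrad_of_mem_sector (not_le.1 h1) h2]
    have h0 : p.1 ≠ 0 := fun h => by rw [h] at h2; norm_num at h2; linarith
    field_simp
  · simp [coneGrad_of_gt (not_le.1 h2)]

lemma coneGrad_nonneg (p : ℝ × ℝ) : 0 ≤ coneGrad p := by rw [coneGrad]; positivity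

lemma coneGrad_le_one (p : ℝ × ℝ) : coneGrad p ≤ 1 := by
  rw [coneGrad]
  refine div_le_one_of_le₀ ?_ (by positivity)
  have := le_max_left (max p.2 0) (p.1 ^ 2 / 2)
  have := le_max_right (-p.2) 0
  linarith

lemma abs_coneGrad_le_one (p : ℝ × ℝ) : |coneGrad p| ≤ 1 := by
  rw [abs_of_nonneg (coneGrad_nonneg p)]; exact coneGrad_le_one p

/-- The summand `max (-p.2) 0` in the denominator serves only this purpose: it is nonzero only where
the numerator vanishes, and it prevents `0 / 0` on the half-line `y = 0`, `t < 0`. -/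
lemma coneGrad_denom_pos {p : ℝ × ℝ} (hp : p ≠ 0) :
    0 < max (max p.2 0) (p.1 ^ 2 / 2) + max (-p.2) 0 := by
  by_contra! h
  have h1 := le_max_left (max p.2 0) (p.1 ^ 2 / 2)
  have h2 := le_max_right (max p.2 0) (p.1 ^ 2 / 2)
  have h3 := le_max_left p.2 0
  have h3' := le_max_right p.2 0
  have h4 := le_max_left (-p.2) 0
  have h5 := le_max_right (-p.2) 0
  have h6 : p.2 = 0 := by linarith
  have h7 : p.1 ^ 2 = 0 := by nlinarith
  exact hp (Prod.ext (by simpa using h7) h6)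

lemma continuousOn_coneGrad : ContinuousOn coneGrad {(0 : ℝ × ℝ)}ᶜ := by
  refine ContinuousOn.div (by fun_prop) (by fun_prop) fun p hp => (coneGrad_denom_pos hp).ne'

lemma abs_coneFun_le (p : ℝ × ℝ) : |coneFun p| ≤ |p.1| := by
  rw [coneFun_eq, abs_mul]
  exact mul_le_of_le_one_right (abs_nonneg _) (abs_coneGrad_le_one p)

lemma continuous_coneFun : Continuous coneFun := by
  rw [continuous_iff_continuousAt]
  intro p
  by_cases hp : p = 0
  · subst hp
    have h0 : coneFun 0 = 0 := by simp [coneFun_eq]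
    rw [ContinuousAt, h0]
    -- `coneGrad` has no limit at the origin, but it is bounded and the factor `y` tends to `0`.
    refine squeeze_zero_norm (a := fun p : ℝ × ℝ => |p.1|) abs_coneFun_le ?_
    have : Continuous fun p : ℝ × ℝ => |p.1| := by fun_prop
    simpa using this.tendsto 0
  · have h := continuousOn_coneGrad.continuousAt (isOpen_compl_singleton.mem_nhds hp)
    refine (continuousAt_fst.mul h).congr (Eventually.of_forall fun q => (coneFun_eq q).symm)

/-- The maxima are Lipschitz but not differentiable, so `coneFun` is split into a locally Lipschitz
map to `ℝ⁴` followed by a rational function that is `C¹` where its denominator is nonzero. -/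
lemma locallyLipschitzOn_coneFun : LocallyLipschitzOn {(0 : ℝ × ℝ)}ᶜ coneFun := by
  have hmax : LocallyLipschitz fun p : ℝ × ℝ => max p.1 p.2 := lipschitzWith_max.locallyLipschitz
  have h1 : LocallyLipschitz fun p : ℝ × ℝ => max p.2 0 :=
    hmax.comp (ContDiff.locallyLipschitz (𝕂 := ℝ) (f := fun p : ℝ × ℝ => (p.2, (0 : ℝ)))
      (by fun_prop))
  have h2 : LocallyLipschitz fun p : ℝ × ℝ => max (-p.2) 0 :=
    hmax.comp (ContDiff.locallyLipschitz (𝕂 := ℝ) (f := fun p : ℝ × ℝ => (-p.2, (0 : ℝ)))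
      (by fun_prop))
  have h3 : LocallyLipschitz fun p : ℝ × ℝ => max (max p.2 0) (p.1 ^ 2 / 2) :=
    hmax.comp (h1.prodMk (ContDiff.locallyLipschitz (𝕂 := ℝ)
      (f := fun p : ℝ × ℝ => p.1 ^ 2 / 2) (by fun_prop)))
  have h4 : LocallyLipschitz fun p : ℝ × ℝ =>
      (p.1, max p.2 0, max (max p.2 0) (p.1 ^ 2 / 2), max (-p.2) 0) :=
    LipschitzWith.prod_fst.locallyLipschitz.prodMk (h1.prodMk (h3.prodMk h2))
  intro p hp
  have hd := coneGrad_denom_pos hp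
  obtain ⟨K, s, hs, hK⟩ := h4 p
  have hΦ : ContDiffAt ℝ 1 (fun q : ℝ × ℝ × ℝ × ℝ => q.1 * (q.2.1 / (q.2.2.1 + q.2.2.2)))
      (p.1, max p.2 0, max (max p.2 0) (p.1 ^ 2 / 2), max (-p.2) 0) :=
    contDiffAt_fst.mul (ContDiffAt.div (by fun_prop) (by fun_prop) hd.ne')
  obtain ⟨K', s', hs', hK'⟩ := hΦ.exists_lipschitzOnWith
  refine ⟨K' * K, s ∩ (fun p : ℝ × ℝ =>
    (p.1, max p.2 0, max (max p.2 0) (p.1 ^ 2 / 2), max (-p.2) 0)) ⁻¹' s',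
    mem_nhdsWithin_of_mem_nhds (inter_mem hs (h4.continuous.continuousAt hs')), ?_⟩
  have hcomp := hK'.comp (hK.mono inter_subset_left) (fun q hq => hq.2)
  intro q hq q' hq'
  rw [coneFun_eq, coneFun_eq]
  exact hcomp hq hq'

open Classical in
/-- The derivative of `coneGrad` in the second variable. -/
noncomputable def coneGradSnd (p : ℝ × ℝ) : ℝ :=
  if 0 < p.2 ∧ p.2 ≤ p.1 ^ 2 / 2 then 2 / p.1 ^ 2 else 0

lemma coneGradSnd_nonneg (p : ℝ × ℝ) : 0 ≤ coneGradSnd p := by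
  rw [coneGradSnd]; split_ifs <;> positivity

/-- The derivative of `coneFun` in the second variable. -/
noncomputable def coneFunSnd (p : ℝ × ℝ) : ℝ := p.1 * coneGradSnd p

/-- The derivative of `coneFun` in the first variable. -/
noncomputable def coneFunFst (p : ℝ × ℝ) : ℝ := coneGrad p - coneFun p * coneFunSnd p

/-- A single branch of the definition is valid on a whole neighbourhood, so derivatives may be
computed branch by branch. -/
lemma IsRegularPoint.cases {p : ℝ × ℝ} (hp : IsRegularPoint p) :
    (∀ᶠ q : ℝ × ℝ in 𝓝 p, q.2 < 0) ∨ (∀ᶠ q : ℝ × ℝ in 𝓝 p, 0 < q.2 ∧ q.2 < q.1 ^ 2 / 2) ∨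
      ∀ᶠ q : ℝ × ℝ in 𝓝 p, q.1 ^ 2 / 2 < q.2 := by
  have hc : Continuous fun q : ℝ × ℝ => q.1 ^ 2 / 2 := by fun_prop
  have hs : Continuous fun q : ℝ × ℝ => q.2 := continuous_snd
  rcases lt_or_gt_of_ne hp.1 with h | h
  · exact Or.inl ((isOpen_lt hs continuous_const).mem_nhds h)
  · rcases lt_or_gt_of_ne hp.2 with h' | h'
    · exact Or.inr (Or.inl (((isOpen_lt continuous_const hs).inter
        (isOpen_lt hs hc)).mem_nhds ⟨h, h'⟩))
    · exact Or.inr (Or.inr ((isOpen_lt hc hs).mem_nhds h'))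

lemma hasPartialSnd_coneGrad : HasPartialSnd coneGrad coneGradSnd := by
  intro p hp
  have hs : Tendsto (fun t => (p.1, t)) (𝓝 p.2) (𝓝 p) :=
    (Continuous.tendsto (by fun_prop : Continuous fun t : ℝ => (p.1, t)) p.2)
  rcases hp.cases with h | h | h
  · have h0 : coneGradSnd p = 0 := if_neg fun h' => absurd h'.1 (not_lt.2 h.self_of_nhds.le)
    rw [h0]
    refine (hasDerivAt_const p.2 (0 : ℝ)).congr_of_eventuallyEq ?_
    filter_upwards [hs.eventually h] with t ht using coneGrad_of_nonpos ht.le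
  · have h0 : coneGradSnd p = 2 / p.1 ^ 2 := if_pos ⟨h.self_of_nhds.1, h.self_of_nhds.2.le⟩
    rw [h0]
    have : HasDerivAt (fun t => 2 * t / p.1 ^ 2) (2 / p.1 ^ 2) p.2 := by
      simpa using ((hasDerivAt_id p.2).const_mul 2).div_const (p.1 ^ 2)
    refine this.congr_of_eventuallyEq ?_
    filter_upwards [hs.eventually h] with t ht using coneGrad_of_mem_sector ht.1 ht.2.le
  · have h0 : coneGradSnd p = 0 := if_neg fun h' => absurd h'.2 (not_le.2 h.self_of_nhds)
    rw [h0]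
    refine (hasDerivAt_const p.2 (1 : ℝ)).congr_of_eventuallyEq ?_
    filter_upwards [hs.eventually h] with t ht using coneGrad_of_gt ht

/-- The transport equation `∂_y g + f ∂_t g = 0`, on which the computation of `∇^f f` and both
variations rest. On the sector it reads `-4t/y³ = -(2t/y)(2/y²)`; elsewhere `g` is locally constant.
-/
lemma hasPartialFst_coneGrad : HasPartialFst coneGrad fun p => -(coneFun p * coneGradSnd p) := by
  intro p hp
  have hs : Tendsto (fun y => (y, p.2)) (𝓝 p.1) (𝓝 p) :=
    (Continuous.tendsto (by fun_prop : Continuous fun y : ℝ => (y, p.2)) p.1)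
  rcases hp.cases with h | h | h
  · have h0 : coneGradSnd p = 0 := if_neg fun h' => absurd h'.1 (not_lt.2 h.self_of_nhds.le)
    simp only [h0, mul_zero, neg_zero]
    refine (hasDerivAt_const p.1 (0 : ℝ)).congr_of_eventuallyEq ?_
    filter_upwards [hs.eventually h] with t ht using coneGrad_of_nonpos ht.le
  · have h0 : coneGradSnd p = 2 / p.1 ^ 2 := if_pos ⟨h.self_of_nhds.1, h.self_of_nhds.2.le⟩
    have hy : p.1 ≠ 0 := fun hy => by
      have := h.self_of_nhds; rw [hy] at this; norm_num at this; linarith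
    simp only [h0, coneFun_eq, coneGrad_of_mem_sector h.self_of_nhds.1 h.self_of_nhds.2.le]
    have : HasDerivAt (fun y => 2 * p.2 / y ^ 2) (-(p.1 * (2 * p.2 / p.1 ^ 2) * (2 / p.1 ^ 2)))
        p.1 := by
      refine ((hasDerivAt_const p.1 (2 * p.2)).div (hasDerivAt_pow 2 p.1)
        (pow_ne_zero 2 hy)).congr_deriv ?_
      simp
      field_simp
    refine this.congr_of_eventuallyEq ?_
    filter_upwards [hs.eventually h] with t ht using coneGrad_of_mem_sector ht.1 ht.2.le
  · have h0 : coneGradSnd p = 0 := if_neg fun h' => absurd h'.2 (not_le.2 h.self_of_nhds)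
    simp only [h0, mul_zero, neg_zero]
    refine (hasDerivAt_const p.1 (1 : ℝ)).congr_of_eventuallyEq ?_
    filter_upwards [hs.eventually h] with t ht using coneGrad_of_gt ht

lemma hasPartialSnd_coneFun : HasPartialSnd coneFun coneFunSnd := by
  intro p hp
  simp only [coneFun_eq]
  exact (hasPartialSnd_coneGrad p hp).const_mul p.1

lemma hasPartialFst_coneFun : HasPartialFst coneFun coneFunFst := by
  intro p hp
  have h := (hasDerivAt_id p.1).mul (hasPartialFst_coneGrad p hp)
  have he : (fun y => coneFun (y, p.2)) = fun y => id y * coneGrad (y, p.2) := by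
    ext y; simp [coneFun_eq]
  rw [he]
  refine h.congr_deriv ?_
  simp only [coneFunFst, coneFunSnd, id]
  ring

/-! ### Measurability and integrability -/

lemma measurable_coneGrad : Measurable coneGrad := by
  unfold coneGrad
  fun_prop

lemma measurable_coneGradSnd : Measurable coneGradSnd := by
  refine Measurable.ite ?_ (by fun_prop) measurable_const
  exact (measurableSet_lt measurable_const measurable_snd).inter
    (measurableSet_le measurable_snd (by fun_prop))

lemma measurable_coneFunSnd : Measurable coneFunSnd :=
  measurable_fst.mul measurable_coneGradSnd

lemma measurable_coneFunFst : Measurable coneFunFst :=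
  measurable_coneGrad.sub (continuous_coneFun.measurable.mul measurable_coneFunSnd)

lemma coneFunSnd_eq (y t : ℝ) :
    coneFunSnd (y, t) = (Ioc 0 (y ^ 2 / 2)).indicator (fun _ => 2 / y) t := by
  simp only [coneFunSnd, coneGradSnd, indicator, mem_Ioc]
  split_ifs with h
  · have : y ≠ 0 := fun hy => by rw [hy] at h; norm_num at h; linarith
    field_simp
  · simp

/-- Both sides are `4/y²` on the sector. Local integrability of `∂_t g` thus follows from `∂_t f`
being locally in `L²`. -/
lemma coneFunSnd_sq (p : ℝ × ℝ) : coneFunSnd p ^ 2 = 2 * coneGradSnd p := by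
  simp only [coneFunSnd, coneGradSnd]
  split_ifs with h
  · have : p.1 ≠ 0 := fun hy => by rw [hy] at h; norm_num at h; linarith
    field_simp
  · simp

/-- The singularity `2/y` of `∂_t f` is absorbed by `|f| ≤ |y|`; therefore `∂_y f` is bounded
although `∂_t f` is not. -/
lemma abs_coneFun_mul_coneFunSnd_le (p : ℝ × ℝ) : |coneFun p * coneFunSnd p| ≤ 2 := by
  rw [coneFun_eq, coneFunSnd]
  have h2 : p.1 ^ 2 * coneGradSnd p ≤ 2 := by
    simp only [coneGradSnd]
    split_ifs with h
    · have : p.1 ≠ 0 := fun hy => by rw [hy] at h; norm_num at h; linarith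
      field_simp; rfl
    · simp
  have h3 : p.1 * coneGrad p * (p.1 * coneGradSnd p) = coneGrad p * (p.1 ^ 2 * coneGradSnd p) := by
    ring
  have h4 := coneGradSnd_nonneg p
  have h5 := coneGrad_nonneg p
  rw [h3, abs_of_nonneg (by positivity)]
  nlinarith [coneGrad_le_one p]

lemma abs_coneFunFst_le (p : ℝ × ℝ) : |coneFunFst p| ≤ 3 := by
  refine (abs_sub _ _).trans ?_
  linarith [abs_coneGrad_le_one p, abs_coneFun_mul_coneFunSnd_le p]

lemma integrableOn_abs_rpow {r : ℝ} (hr : -1 < r) (R : ℝ) :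
    IntegrableOn (fun y : ℝ => |y| ^ r) (Icc (-R) R) := by
  rcases lt_or_ge R 0 with hR | hR
  · simp [Icc_eq_empty (show ¬ -R ≤ R by linarith)]
  have h := (intervalIntegrable_of_even (f := fun y : ℝ => |y| ^ r) (fun x => by simp)
    (fun x hx => (intervalIntegral.intervalIntegrable_rpow' (a := 0) (b := x) hr).congr
      fun y hy => ?_) (a := -R) (b := R) (by simp) (by simp)).1
  · rwa [← integrableOn_Icc_iff_integrableOn_Ioc] at h
  · rw [uIoc_of_le hx.le] at hy
    simp only [abs_of_pos hy.1]

/-- The slice at `y` contributes `|2/y|^q · y²/2 = 2^(q-1) |y|^(2-q)`, integrable near `y = 0`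
exactly when `q < 3`. No bound on `t` is needed because each slice of the sector is bounded. -/
lemma lintegral_coneFunSnd_rpow_lt_top {q : ℝ} (hq : 1 ≤ q) (hq' : q < 3) (R : ℝ) :
    ∫⁻ p in Icc (-R) R ×ˢ (univ : Set ℝ), ‖coneFunSnd p‖ₑ ^ q < ∞ := by
  rw [Measure.volume_eq_prod, ← Measure.prod_restrict, lintegral_prod _
    (measurable_coneFunSnd.enorm.pow_const q).aemeasurable, Measure.restrict_univ]
  have h1 : ∀ y : ℝ, y ≠ 0 → ∫⁻ t, ‖coneFunSnd (y, t)‖ₑ ^ q =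
      ENNReal.ofReal (2 ^ (q - 1) * |y| ^ (2 - q)) := by
    intro y hy
    have : (fun t => ‖coneFunSnd (y, t)‖ₑ ^ q) =
        (Ioc 0 (y ^ 2 / 2)).indicator fun _ => ‖2 / y‖ₑ ^ q := by
      ext t
      rw [coneFunSnd_eq]
      simp only [indicator]
      split_ifs <;> simp [show 0 < q by linarith]
    have hy' : 0 < |y| := abs_pos.2 hy
    rw [this, lintegral_indicator measurableSet_Ioc, setLIntegral_const, Real.volume_Ioc, sub_zero,
      Real.enorm_eq_ofReal_abs, ENNReal.ofReal_rpow_of_nonneg (abs_nonneg _) (by linarith),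
      ← ENNReal.ofReal_mul (by positivity)]
    congr 1
    rw [abs_div, abs_two, Real.div_rpow (by norm_num) hy'.le, Real.rpow_sub hy',
      Real.rpow_sub (by norm_num : (0 : ℝ) < 2), Real.rpow_one, ← sq_abs y, Real.rpow_two]
    field_simp
  have h2 : ∀ᵐ y : ℝ ∂volume.restrict (Icc (-R) R), ∫⁻ t, ‖coneFunSnd (y, t)‖ₑ ^ q =
      ENNReal.ofReal (2 ^ (q - 1) * |y| ^ (2 - q)) := by
    refine ae_restrict_of_ae ?_
    have : ∀ᵐ y : ℝ, y ≠ 0 := by simp [ae_iff]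
    filter_upwards [this] with y hy using h1 y hy
  rw [lintegral_congr_ae h2]
  exact (((integrableOn_abs_rpow (r := 2 - q) (by linarith) R).const_mul _).lintegral_lt_top)

lemma memLp_coneFunSnd {p : ℝ≥0∞} (hp : 1 ≤ p) (hp' : p < 3) {K : Set (ℝ × ℝ)}
    (hK : IsCompact K) : MemLp coneFunSnd p (volume.restrict K) := by
  refine ⟨measurable_coneFunSnd.aestronglyMeasurable, ?_⟩
  have hp0 : p ≠ 0 := (zero_lt_one.trans_le hp).ne'
  have hpt : p ≠ ∞ := (hp'.trans (by simp)).ne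
  rw [eLpNorm_lt_top_iff_lintegral_rpow_enorm_lt_top hp0 hpt]
  obtain ⟨R, hR⟩ := hK.isBounded.subset_closedBall 0
  refine (lintegral_mono_set (fun x hx => ?_)).trans_lt
    (lintegral_coneFunSnd_rpow_lt_top (q := p.toReal) ?_ ?_ R)
  · have := hR hx
    simp only [mem_closedBall_zero_iff, Prod.norm_def, Real.norm_eq_abs, sup_le_iff] at this
    exact ⟨abs_le.1 this.1, mem_univ _⟩
  · simpa using ENNReal.toReal_mono hpt hp
  · simpa using ENNReal.toReal_strict_mono (by simp) hp'

lemma locallyIntegrable_coneFunSnd : LocallyIntegrable coneFunSnd :=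
  locallyIntegrable_iff.2 fun K hK => memLp_one_iff_integrable.1
    (memLp_coneFunSnd le_rfl (by norm_num) hK)

lemma locallyIntegrable_coneGradSnd : LocallyIntegrable coneGradSnd := by
  refine locallyIntegrable_iff.2 fun K hK => ?_
  have := (memLp_coneFunSnd (p := 2) (by norm_num) (by norm_num) hK).integrable_sq.div_const 2
  refine this.congr (Eventually.of_forall fun p => ?_)
  simp only [coneFunSnd_sq]
  ring

lemma memLp_restrict_of_bounded {F : ℝ × ℝ → ℝ} (hm : Measurable F) {C : ℝ}
    (hC : ∀ p, |F p| ≤ C) {K : Set (ℝ × ℝ)} (hK : IsCompact K) (p : ℝ≥0∞) :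
    MemLp F p (volume.restrict K) := by
  have : IsFiniteMeasure (volume.restrict K) := ⟨by simpa using hK.measure_lt_top⟩
  exact MemLp.of_bound hm.aestronglyMeasurable C (Eventually.of_forall hC)

lemma locallyIntegrable_of_bounded {F : ℝ × ℝ → ℝ} (hm : Measurable F) {C : ℝ}
    (hC : ∀ p, |F p| ≤ C) : LocallyIntegrable F :=
  locallyIntegrable_iff.2 fun _ hK => memLp_one_iff_integrable.1
    (memLp_restrict_of_bounded hm hC hK 1)

lemma hasWeakDeriv_coneFun_fst : HasWeakDeriv univ (1, 0) coneFun coneFunFst :=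
  .of_partialFst continuous_coneFun.continuousOn hasPartialFst_coneFun
    continuous_coneFun.locallyIntegrable
    (locallyIntegrable_of_bounded measurable_coneFunFst abs_coneFunFst_le)

lemma hasWeakDeriv_coneFun_snd : HasWeakDeriv univ (0, 1) coneFun coneFunSnd :=
  .of_partialSnd continuous_coneFun.continuousOn hasPartialSnd_coneFun
    continuous_coneFun.locallyIntegrable locallyIntegrable_coneFunSnd

lemma memW1pLoc_coneFun {p : ℝ≥0∞} (hp : 1 ≤ p) (hp' : p < 3) : MemW1pLoc univ p coneFun := by
  refine ⟨coneFunFst, coneFunSnd, hasWeakDeriv_coneFun_fst, hasWeakDeriv_coneFun_snd,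
    fun K hK _ => ⟨?_, memLp_restrict_of_bounded measurable_coneFunFst abs_coneFunFst_le hK p,
      memLp_coneFunSnd hp hp' hK⟩⟩
  have : IsFiniteMeasure (volume.restrict K) := ⟨by simpa using hK.measure_lt_top⟩
  obtain ⟨C, hC⟩ := hK.exists_bound_of_continuousOn continuous_coneFun.continuousOn
  exact MemLp.of_bound continuous_coneFun.aestronglyMeasurable C
    (ae_restrict_of_forall_mem hK.measurableSet hC)

lemma intrinsicGradient_coneFun_ae_eq : intrinsicGradient univ coneFun =ᵐ[volume] coneGrad := by
  refine (intrinsicGradient_ae_eq hasWeakDeriv_coneFun_fst hasWeakDeriv_coneFun_snd).trans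
    (Eventually.of_forall fun p => ?_)
  simp [coneFunFst]

lemma memLp_top_intrinsicGradient_coneFun : MemLp (intrinsicGradient univ coneFun) ∞ volume :=
  (memLp_top_of_bound measurable_coneGrad.aestronglyMeasurable 1
    (Eventually.of_forall abs_coneGrad_le_one)).ae_eq intrinsicGradient_coneFun_ae_eq.symm

/-! ### The intrinsic graph -/

/-- Since `(0,y,t)(x,0,0) = (x, y, t - xy/2)`, the parameter of a point is recovered as `t = z +
xy/2`. -/
lemma mem_intrinsicGraph_iff {f : ℝ × ℝ → ℝ} {q : Heis} :
    q ∈ intrinsicGraph univ f ↔ q.1 = f (q.2.1, q.2.2 + q.1 * q.2.1 / 2) := by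
  constructor
  · rintro ⟨y, t, -, rfl⟩
    simp only [heisMul]
    ring_nf
  · intro h
    refine ⟨q.2.1, q.2.2 + q.1 * q.2.1 / 2, mem_univ _, ?_⟩
    rw [← h]
    simp only [heisMul]
    ext <;> simp
    ring

lemma mem_intrinsicSubgraph_iff {f : ℝ × ℝ → ℝ} {q : Heis} :
    q ∈ intrinsicSubgraph univ f ↔ q.1 ≤ f (q.2.1, q.2.2 + q.1 * q.2.1 / 2) := by
  constructor
  · rintro ⟨y, t, ξ, -, h, rfl⟩
    simp only [heisMul]
    ring_nf
    simpa using h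
  · intro h
    refine ⟨q.2.1, q.2.2 + q.1 * q.2.1 / 2, q.1, mem_univ _, h, ?_⟩
    simp only [heisMul]
    ext <;> simp
    ring

/-- With `t = z + xy/2`, the three branches become `x = 0` with `t = z`; `xy = 2t`, that is `z = 0`;
and `x = y`, where `t > y²/2` means `z > 0`. -/
lemma intrinsicGraph_coneFun : intrinsicGraph univ coneFun =
    {q : Heis | q.1 = 0 ∧ q.2.2 ≤ 0} ∪
      ({q : Heis | 0 ≤ q.1 ∧ q.1 ≤ q.2.1 ∧ q.2.2 = 0} ∪
        {q : Heis | q.2.1 ≤ q.1 ∧ q.1 ≤ 0 ∧ q.2.2 = 0}) ∪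
      {q : Heis | q.1 = q.2.1 ∧ 0 ≤ q.2.2} := by
  ext ⟨x, y, z⟩
  simp only [mem_intrinsicGraph_iff, mem_union, mem_ofPred_eq, coneFun]
  constructor
  · split_ifs with h1 h2
    · rintro rfl
      simp at h1
      exact Or.inl (Or.inl ⟨rfl, h1⟩)
    · intro h
      have h0 : y ≠ 0 := fun hy => by rw [hy] at h1 h2; norm_num at h1 h2; linarith
      rw [eq_div_iff h0] at h
      have hz : z = 0 := by linarith
      subst hz
      refine Or.inl (Or.inr ?_)
      rcases lt_or_gt_of_ne h0 with hy | hy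
      · right
        refine ⟨?_, ?_, rfl⟩ <;> nlinarith
      · left
        refine ⟨?_, ?_, rfl⟩ <;> nlinarith
    · rintro rfl
      exact Or.inr ⟨rfl, by nlinarith⟩
  · rintro ((⟨rfl, hz⟩ | ⟨hx, hxy, rfl⟩ | ⟨hxy, hx, rfl⟩) | ⟨rfl, hz⟩)
    · simp [hz]
    · split_ifs with h1 h2
      · nlinarith
      · have h0 : y ≠ 0 := fun hy => by rw [hy] at h1; norm_num at h1
        field_simp
        simp
      · nlinarith
    · split_ifs with h1 h2
      · nlinarith
      · have h0 : y ≠ 0 := fun hy => by rw [hy] at h1; norm_num at h1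
        field_simp
        simp
      · nlinarith
    · split_ifs with h1 h2
      · nlinarith
      · have hz0 : z = 0 := by nlinarith
        have h0 : x ≠ 0 := fun hy => by rw [hy, hz0] at h1; norm_num at h1
        rw [hz0]
        field_simp
        ring
      · rfl

lemma heisDilation_image_intrinsicGraph_coneFun {l : ℝ} (hl : 0 < l) :
    heisDilation l '' intrinsicGraph univ coneFun = intrinsicGraph univ coneFun := by
  have hsub : ∀ l : ℝ, 0 < l → ∀ q ∈ intrinsicGraph univ coneFun,
      heisDilation l q ∈ intrinsicGraph univ coneFun := by
    rw [intrinsicGraph_coneFun]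
    rintro l hl ⟨x, y, z⟩ h
    simp only [heisDilation, mem_union, mem_ofPred_eq] at h ⊢
    rcases h with (⟨rfl, hz⟩ | ⟨hx, hxy, rfl⟩ | ⟨hxy, hx, rfl⟩) | ⟨rfl, hz⟩
    · exact Or.inl (Or.inl ⟨by simp, mul_nonpos_of_nonneg_of_nonpos (by positivity) hz⟩)
    · exact Or.inl (Or.inr (Or.inl ⟨by positivity, by gcongr, by simp⟩))
    · exact Or.inl (Or.inr (Or.inr ⟨by gcongr, mul_nonpos_of_nonneg_of_nonpos hl.le hx, by simp⟩))
    · exact Or.inr ⟨rfl, by positivity⟩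
  refine Subset.antisymm ?_ fun q hq => ⟨heisDilation l⁻¹ q, hsub _ (inv_pos.2 hl) q hq, ?_⟩
  · rintro _ ⟨q, hq, rfl⟩
    exact hsub l hl q hq
  · ext <;> simp [heisDilation, hl.ne']

lemma not_isIntrinsicPlane_coneFun : ¬ IsIntrinsicPlane (intrinsicGraph univ coneFun) := by
  rintro ⟨H, hH, -, -, p, hp⟩
  -- The graph contains the identity, so a coset equal to it is the subgroup itself. It is then
  -- refuted by `(1,1,1)`, whose inverse is not on the graph.
  have hmem : ∀ q : Heis, q ∈ intrinsicGraph univ coneFun ↔ q ∈ H := by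
    have h0 : (0 : Heis) ∈ intrinsicGraph univ coneFun := by
      rw [mem_intrinsicGraph_iff]; simp [coneFun]
    obtain ⟨r, hr, hr0⟩ := hp ▸ h0
    have hpr : p = heisInv r := by
      simp only [heisMul, Prod.ext_iff, Prod.fst_zero, Prod.snd_zero] at hr0
      obtain ⟨h1, h2, h3⟩ := hr0
      have e1 : p.1 = -r.1 := by linarith
      have e2 : p.2.1 = -r.2.1 := by linarith
      rw [e1, e2] at h3
      simp only [heisInv, Prod.ext_iff]
      exact ⟨e1, e2, by linarith⟩
    have hpH : p ∈ H := hpr ▸ hH.inv_mem r hr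
    intro q
    rw [hp]
    constructor
    · rintro ⟨s, hs, rfl⟩
      exact hH.mul_mem _ hpH _ hs
    · intro hq
      refine ⟨heisMul r q, hH.mul_mem _ hr _ hq, ?_⟩
      rw [hpr]
      simp only [heisMul, heisInv]
      ext <;> simp
      ring
  have h1 : ((1, 1, 1) : Heis) ∈ H := by
    rw [← hmem, intrinsicGraph_coneFun]
    exact Or.inr ⟨rfl, zero_le_one⟩
  have h2 := hH.inv_mem _ h1
  rw [← hmem, intrinsicGraph_coneFun] at h2
  simp [heisInv] at h2
  norm_num at h2

/-! ### The area integrand -/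

/-- The derivative of `s ↦ √(1 + s²)`. -/
noncomputable def unitSlope (s : ℝ) : ℝ := s / √(1 + s ^ 2)

/-- The second derivative of `s ↦ √(1 + s²)`. -/
noncomputable def slopeDensity (s : ℝ) : ℝ := 1 / √(1 + s ^ 2) ^ 3

lemma one_le_sqrt_one_add_sq (s : ℝ) : 1 ≤ √(1 + s ^ 2) :=
  Real.one_le_sqrt.2 (by nlinarith [sq_nonneg s])

lemma sq_sqrt_one_add_sq (s : ℝ) : √(1 + s ^ 2) ^ 2 = 1 + s ^ 2 :=
  Real.sq_sqrt (by positivity)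

lemma hasDerivAt_sqrt_one_add_sq (s : ℝ) :
    HasDerivAt (fun s : ℝ => √(1 + s ^ 2)) (unitSlope s) s := by
  have h : HasDerivAt (fun s : ℝ => 1 + s ^ 2) (2 * s) s := by
    simpa using (hasDerivAt_pow 2 s).const_add 1
  refine (h.sqrt (by positivity)).congr_deriv ?_
  rw [unitSlope]
  ring

lemma hasDerivAt_unitSlope (s : ℝ) : HasDerivAt unitSlope (slopeDensity s) s := by
  have h1 := one_le_sqrt_one_add_sq s
  have h2 := sq_sqrt_one_add_sq s
  refine ((hasDerivAt_id s).div (hasDerivAt_sqrt_one_add_sq s) (by positivity)).congr_deriv ?_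
  rw [slopeDensity, unitSlope, id]
  have h0 : √(1 + s ^ 2) ≠ 0 := by positivity
  field_simp
  linarith

lemma continuous_unitSlope : Continuous unitSlope :=
  continuous_iff_continuousAt.2 fun s => (hasDerivAt_unitSlope s).continuousAt

lemma continuous_slopeDensity : Continuous slopeDensity := by
  unfold slopeDensity
  exact continuous_const.div (by fun_prop) fun s => by
    have := one_le_sqrt_one_add_sq s
    positivity

lemma abs_unitSlope_le_one (s : ℝ) : |unitSlope s| ≤ 1 := by
  have h1 := one_le_sqrt_one_add_sq s
  rw [unitSlope, abs_div, abs_of_nonneg (Real.sqrt_nonneg _)]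
  exact div_le_one_of_le₀ (Real.abs_le_sqrt (by linarith)) (by positivity)

lemma slopeDensity_nonneg (s : ℝ) : 0 ≤ slopeDensity s := by
  rw [slopeDensity]; positivity

lemma slopeDensity_le_one (s : ℝ) : slopeDensity s ≤ 1 := by
  rw [slopeDensity]
  have h1 := one_le_sqrt_one_add_sq s
  exact div_le_one_of_le₀ (one_le_pow₀ h1) (by positivity)

/-! ### Differentiating the area twice under the integral sign -/

section Variation

variable {α : Type*} [MeasurableSpace α] {μ : Measure α} {g a b : α → ℝ} {C : ℝ}

lemma hasDerivAt_quadratic (x y z ε : ℝ) :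
    HasDerivAt (fun ε : ℝ => x + ε * y + ε ^ 2 * z) (y + 2 * ε * z) ε := by
  refine ((((hasDerivAt_id ε).mul_const y).const_add x).add
    ((hasDerivAt_pow 2 ε).mul_const z)).congr_deriv ?_
  simp

lemma aestronglyMeasurable_quadratic (hg : AEStronglyMeasurable g μ)
    (ha : AEStronglyMeasurable a μ) (hb : AEStronglyMeasurable b μ) (ε : ℝ) :
    AEStronglyMeasurable (fun p => g p + ε * a p + ε ^ 2 * b p) μ :=
  (hg.add (ha.const_mul ε)).add (hb.const_mul _)

lemma integrable_area [IsFiniteMeasure μ] (hg : Integrable g μ)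
    (ha : Integrable a μ) (hb : Integrable b μ) (ε : ℝ) :
    Integrable (fun p => √(1 + (g p + ε * a p + ε ^ 2 * b p) ^ 2)) μ := by
  have hq := (hg.add (ha.const_mul ε)).add (hb.const_mul (ε ^ 2))
  refine ((integrable_const 1).add hq.norm).mono' ?_ (Eventually.of_forall fun p => ?_)
  · exact (by fun_prop : Continuous fun s : ℝ => √(1 + s ^ 2)).comp_aestronglyMeasurable
      hq.aestronglyMeasurable
  · rw [Real.norm_of_nonneg (Real.sqrt_nonneg _)]
    simp only [Pi.add_apply, Real.norm_eq_abs]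
    refine Real.sqrt_le_iff.2 ⟨by positivity, ?_⟩
    nlinarith [abs_nonneg (g p + ε * a p + ε ^ 2 * b p), sq_abs (g p + ε * a p + ε ^ 2 * b p)]

/-- As `|unitSlope| ≤ 1`, the derivative of the integrand is dominated by that of the quadratic, so
`L¹` data suffice. -/
lemma hasDerivAt_area [IsFiniteMeasure μ] (hg : Integrable g μ)
    (ha : Integrable a μ) (hb : Integrable b μ) (ε : ℝ) :
    HasDerivAt (fun ε => ∫ p, √(1 + (g p + ε * a p + ε ^ 2 * b p) ^ 2) ∂μ)
      (∫ p, unitSlope (g p + ε * a p + ε ^ 2 * b p) * (a p + 2 * ε * b p) ∂μ) ε := by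
  refine (hasDerivAt_integral_of_dominated_loc_of_deriv_le (μ := μ) (𝕜 := ℝ)
    (F := fun ε p => √(1 + (g p + ε * a p + ε ^ 2 * b p) ^ 2))
    (F' := fun ε p => unitSlope (g p + ε * a p + ε ^ 2 * b p) * (a p + 2 * ε * b p))
    (bound := fun p => ‖a p‖ + 2 * (|ε| + 1) * ‖b p‖)
    (Metric.ball_mem_nhds ε one_pos) (Eventually.of_forall fun e => ?_)
    (integrable_area hg ha hb ε) ?_ (Eventually.of_forall fun p e he => ?_) ?_
    (Eventually.of_forall fun p e _ => ?_)).2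
  · exact (integrable_area hg ha hb e).aestronglyMeasurable
  · exact (continuous_unitSlope.comp_aestronglyMeasurable (aestronglyMeasurable_quadratic
      hg.1 ha.1 hb.1 ε)).mul (ha.1.add (hb.1.const_mul _))
  · have he' : |e| ≤ |ε| + 1 := by
      rw [Metric.mem_ball, Real.dist_eq] at he
      have := abs_sub_abs_le_abs_sub e ε
      linarith
    rw [norm_mul]
    refine (mul_le_of_le_one_left (norm_nonneg _) (abs_unitSlope_le_one _)).trans ?_
    refine (norm_add_le _ _).trans ?_
    rw [norm_mul, norm_mul]
    simp only [Real.norm_eq_abs, abs_two]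
    gcongr
  · exact ha.norm.add (hb.norm.const_mul _)
  · exact (hasDerivAt_sqrt_one_add_sq _).comp e (hasDerivAt_quadratic _ _ _ e)

/-- Here the derivative of the quadratic enters squared, which is why `a` and `b` must be in `L²`;
of `g` only measurability matters, since both slope functions are bounded. -/
lemma hasDerivAt_area_deriv [IsFiniteMeasure μ] (hg : AEStronglyMeasurable g μ)
    (ha : MemLp a 2 μ) (hb : MemLp b 2 μ) :
    Integrable (fun p => slopeDensity (g p) * a p ^ 2 + 2 * (unitSlope (g p) * b p)) μ ∧
    HasDerivAt (fun ε => ∫ p, unitSlope (g p + ε * a p + ε ^ 2 * b p) * (a p + 2 * ε * b p) ∂μ)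
      (∫ p, slopeDensity (g p) * a p ^ 2 + 2 * (unitSlope (g p) * b p) ∂μ) 0 := by
  have hb1 : Integrable b μ := hb.integrable (by norm_num)
  have hmeas : ∀ e : ℝ, AEStronglyMeasurable
      (fun p => unitSlope (g p + e * a p + e ^ 2 * b p) * (a p + 2 * e * b p)) μ := fun e =>
    (continuous_unitSlope.comp_aestronglyMeasurable (aestronglyMeasurable_quadratic
      hg ha.1 hb.1 e)).mul (ha.1.add (hb.1.const_mul _))
  have h := hasDerivAt_integral_of_dominated_loc_of_deriv_le (μ := μ) (𝕜 := ℝ) (x₀ := 0)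
    (F := fun ε p => unitSlope (g p + ε * a p + ε ^ 2 * b p) * (a p + 2 * ε * b p))
    (F' := fun ε p => slopeDensity (g p + ε * a p + ε ^ 2 * b p) * (a p + 2 * ε * b p) ^ 2 +
      unitSlope (g p + ε * a p + ε ^ 2 * b p) * (2 * b p))
    -- From `(a + 2eb)² ≤ 2a² + 8e²b²` with `|e| ≤ 1`, and `|unitSlope| ≤ 1` for the last term.
    (bound := fun p => (2 * a p ^ 2 + 8 * b p ^ 2) + 2 * ‖b p‖)
    (Metric.ball_mem_nhds 0 one_pos) (Eventually.of_forall hmeas) ?_ ?_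
    (Eventually.of_forall fun p e he => ?_) ?_ (Eventually.of_forall fun p e _ => ?_)
  · have he : ∀ p, slopeDensity (g p + 0 * a p + 0 ^ 2 * b p) * (a p + 2 * 0 * b p) ^ 2 +
        unitSlope (g p + 0 * a p + 0 ^ 2 * b p) * (2 * b p) =
        slopeDensity (g p) * a p ^ 2 + 2 * (unitSlope (g p) * b p) := fun p => by
      norm_num
      ring
    simpa only [he] using h
  · refine (ha.integrable (by norm_num)).norm.mono' (hmeas 0) (Eventually.of_forall fun p => ?_)
    rw [norm_mul]
    simpa using (mul_le_of_le_one_left (norm_nonneg (a p)) (abs_unitSlope_le_one (g p)))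
  · exact ((continuous_slopeDensity.comp_aestronglyMeasurable (aestronglyMeasurable_quadratic
      hg ha.1 hb.1 0)).mul ((ha.1.add (hb.1.const_mul _)).pow 2)).add
      ((continuous_unitSlope.comp_aestronglyMeasurable (aestronglyMeasurable_quadratic
      hg ha.1 hb.1 0)).mul (hb.1.const_mul 2))
  · have he' : e ^ 2 ≤ 1 := by
      rw [Metric.mem_ball, dist_zero_right] at he
      exact (sq_le_one_iff_abs_le_one e).2 he.le
    refine (norm_add_le _ _).trans (add_le_add ?_ ?_)
    · rw [norm_mul, Real.norm_of_nonneg (slopeDensity_nonneg _), Real.norm_of_nonneg (sq_nonneg _)]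
      refine (mul_le_of_le_one_left (sq_nonneg _) (slopeDensity_le_one _)).trans ?_
      nlinarith [sq_nonneg (a p - 2 * e * b p), sq_nonneg (b p),
        mul_le_mul_of_nonneg_right he' (sq_nonneg (b p))]
    · rw [norm_mul]
      refine (mul_le_of_le_one_left (norm_nonneg _) (abs_unitSlope_le_one _)).trans ?_
      simp
  · exact ((ha.integrable_sq.const_mul 2).add (hb.integrable_sq.const_mul 8)).add
      (hb1.norm.const_mul 2)
  · refine (((hasDerivAt_unitSlope _).comp e (hasDerivAt_quadratic _ _ _ e)).mul
      ((((hasDerivAt_id e).const_mul 2).mul_const (b p)).const_add (a p))).congr_deriv ?_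
    simp only [id, Function.comp]
    ring

end Variation

/-! ### Stability of the cone -/

/-- The derivative of `unitSlope ∘ coneGrad` in the second variable. -/
noncomputable def coneSlopeSnd (p : ℝ × ℝ) : ℝ := slopeDensity (coneGrad p) * coneGradSnd p

lemma measurable_coneSlopeSnd : Measurable coneSlopeSnd :=
  (continuous_slopeDensity.measurable.comp measurable_coneGrad).mul measurable_coneGradSnd

lemma measurable_coneSlope : Measurable fun p => unitSlope (coneGrad p) :=
  continuous_unitSlope.measurable.comp measurable_coneGrad

lemma hasPartialSnd_coneSlope : HasPartialSnd (fun p => unitSlope (coneGrad p)) coneSlopeSnd :=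
  fun p hp => (hasDerivAt_unitSlope _).comp p.2 (hasPartialSnd_coneGrad p hp)

lemma hasPartialFst_coneSlope : HasPartialFst (fun p => unitSlope (coneGrad p))
    fun p => -(coneFun p * coneSlopeSnd p) := fun p hp =>
  ((hasDerivAt_unitSlope _).comp p.1 (hasPartialFst_coneGrad p hp)).congr_deriv (by
    simp only [coneSlopeSnd]; ring)

lemma continuousOn_coneSlope : ContinuousOn (fun p => unitSlope (coneGrad p)) {(0 : ℝ × ℝ)}ᶜ :=
  continuous_unitSlope.comp_continuousOn continuousOn_coneGrad

lemma locallyIntegrable_coneSlope : LocallyIntegrable fun p => unitSlope (coneGrad p) :=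
  locallyIntegrable_of_bounded measurable_coneSlope fun _ => abs_unitSlope_le_one _

lemma locallyIntegrable_coneSlopeSnd : LocallyIntegrable coneSlopeSnd := by
  refine locallyIntegrable_coneGradSnd.mono measurable_coneSlopeSnd.aestronglyMeasurable
    (Eventually.of_forall fun p => ?_)
  rw [coneSlopeSnd, norm_mul, Real.norm_of_nonneg (slopeDensity_nonneg _)]
  exact mul_le_of_le_one_left (norm_nonneg _) (slopeDensity_le_one _)

lemma locallyIntegrable_coneFun_mul_coneSlopeSnd :
    LocallyIntegrable fun p => coneFun p * coneSlopeSnd p := by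
  refine locallyIntegrable_coneFunSnd.mono
    (continuous_coneFun.measurable.mul measurable_coneSlopeSnd).aestronglyMeasurable
    (Eventually.of_forall fun p => ?_)
  rw [coneSlopeSnd, coneFunSnd, norm_mul, norm_mul, norm_mul,
    Real.norm_of_nonneg (slopeDensity_nonneg _)]
  exact mul_le_mul (abs_coneFun_le p) (mul_le_of_le_one_left (norm_nonneg _)
    (slopeDensity_le_one _)) (mul_nonneg (slopeDensity_nonneg _) (norm_nonneg _)) (abs_nonneg _)

lemma locallyIntegrable_coneSlope_mul_coneFunSnd :
    LocallyIntegrable fun p => unitSlope (coneGrad p) * coneFunSnd p := by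
  refine locallyIntegrable_coneFunSnd.mono
    (measurable_coneSlope.mul measurable_coneFunSnd).aestronglyMeasurable
    (Eventually.of_forall fun p => ?_)
  rw [norm_mul]
  exact mul_le_of_le_one_left (norm_nonneg _) (abs_unitSlope_le_one _)

lemma locallyIntegrable_coneSlope_mul_coneFun :
    LocallyIntegrable fun p => unitSlope (coneGrad p) * coneFun p := by
  refine continuous_coneFun.locallyIntegrable.mono
    (measurable_coneSlope.mul continuous_coneFun.measurable).aestronglyMeasurable
    (Eventually.of_forall fun p => ?_)
  rw [norm_mul]
  exact mul_le_of_le_one_left (norm_nonneg _) (abs_unitSlope_le_one _)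

/-- The linearization of the intrinsic gradient at `coneFun` in the direction `φ`. -/
noncomputable def coneVariation (φ : ℝ × ℝ → ℝ) (p : ℝ × ℝ) : ℝ :=
  fderiv ℝ φ p (1, 0) + coneFun p * fderiv ℝ φ p (0, 1) + coneFunSnd p * φ p

section Stability

variable {φ : ℝ × ℝ → ℝ}

lemma coneVariation_eq_zero {p : ℝ × ℝ} (hp : p ∉ tsupport φ) : coneVariation φ p = 0 := by
  have h1 : fderiv ℝ φ p = 0 :=
    image_eq_zero_of_notMem_tsupport fun h => hp (tsupport_fderiv_subset ℝ h)
  simp [coneVariation, h1, image_eq_zero_of_notMem_tsupport hp]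

/-- The expansion is exact and stops at `ε²`, because `f ↦ ∂_y f + f ∂_t f` is quadratic. -/
lemma intrinsicGradient_coneFun_add (hφ : IsTestFunction univ φ) (ε : ℝ) :
    intrinsicGradient univ (fun p => coneFun p + ε * φ p) =ᵐ[volume]
      fun p => coneGrad p + ε * coneVariation φ p + ε ^ 2 * (φ p * fderiv ℝ φ p (0, 1)) := by
  have hc : Continuous fun p => coneFun p + ε * φ p :=
    continuous_coneFun.add (continuous_const.mul hφ.continuous)
  have hy : HasWeakDeriv univ (1, 0) (fun p => coneFun p + ε * φ p)
      fun p => coneFunFst p + ε * fderiv ℝ φ p (1, 0) :=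
    .of_partialFst hc.continuousOn (fun p hp => (hasPartialFst_coneFun p hp).add
      ((hasDerivAt_slice_fst hφ.differentiable.differentiableAt).const_mul ε))
      hc.locallyIntegrable
      ((locallyIntegrableOn_univ.1 hasWeakDeriv_coneFun_fst.2.1).add
        (continuous_const.mul (hφ.fderiv_apply (1, 0)).continuous).locallyIntegrable)
  have ht : HasWeakDeriv univ (0, 1) (fun p => coneFun p + ε * φ p)
      fun p => coneFunSnd p + ε * fderiv ℝ φ p (0, 1) :=
    .of_partialSnd hc.continuousOn (fun p hp => (hasPartialSnd_coneFun p hp).add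
      ((hasDerivAt_slice_snd hφ.differentiable.differentiableAt).const_mul ε))
      hc.locallyIntegrable
      (locallyIntegrable_coneFunSnd.add
        (continuous_const.mul (hφ.fderiv_apply (0, 1)).continuous).locallyIntegrable)
  refine (intrinsicGradient_ae_eq hy ht).trans (Eventually.of_forall fun p => ?_)
  simp only [coneFunFst, coneVariation]
  ring

lemma memLp_coneVariation (hφ : IsTestFunction univ φ) :
    MemLp (coneVariation φ) 2 (volume.restrict (tsupport φ)) := by
  have hK : IsCompact (tsupport φ) := hφ.hasCompactSupport
  have : IsFiniteMeasure (volume.restrict (tsupport φ)) := ⟨by simpa using hK.measure_lt_top⟩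
  have h1 : Continuous fun p => fderiv ℝ φ p (1, 0) + coneFun p * fderiv ℝ φ p (0, 1) :=
    (hφ.fderiv_apply _).continuous.add (continuous_coneFun.mul (hφ.fderiv_apply _).continuous)
  obtain ⟨C, hC⟩ := hK.exists_bound_of_continuousOn h1.continuousOn
  obtain ⟨D, hD⟩ := hφ.continuous.bounded_above_of_compact_support hφ.hasCompactSupport
  refine (MemLp.of_bound h1.aestronglyMeasurable C
    (ae_restrict_of_forall_mem hK.measurableSet hC)).add ?_
  refine ((memLp_coneFunSnd (by norm_num) (by norm_num) hK).const_mul D).mono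
    (measurable_coneFunSnd.aestronglyMeasurable.mul hφ.continuous.aestronglyMeasurable)
    (Eventually.of_forall fun p => ?_)
  rw [norm_mul, norm_mul, mul_comm]
  exact mul_le_mul_of_nonneg_right ((hD p).trans (le_abs_self _)) (norm_nonneg _)

lemma memLp_coneVariation_sq (hφ : IsTestFunction univ φ) :
    MemLp (fun p => φ p * fderiv ℝ φ p (0, 1)) 2 (volume.restrict (tsupport φ)) := by
  have hK : IsCompact (tsupport φ) := hφ.hasCompactSupport
  have : IsFiniteMeasure (volume.restrict (tsupport φ)) := ⟨by simpa using hK.measure_lt_top⟩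
  have h1 : Continuous fun p => φ p * fderiv ℝ φ p (0, 1) :=
    hφ.continuous.mul (hφ.fderiv_apply _).continuous
  obtain ⟨C, hC⟩ := hK.exists_bound_of_continuousOn h1.continuousOn
  exact MemLp.of_bound h1.aestronglyMeasurable C (ae_restrict_of_forall_mem hK.measurableSet hC)

lemma areaAlong_coneFun (hφ : IsTestFunction univ φ) (ε : ℝ) :
    areaAlong univ coneFun φ ε = ENNReal.ofReal (∫ p in tsupport φ,
      √(1 + (coneGrad p + ε * coneVariation φ p + ε ^ 2 * (φ p * fderiv ℝ φ p (0, 1))) ^ 2)) := by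
  have hK : IsCompact (tsupport φ) := hφ.hasCompactSupport
  have : IsFiniteMeasure (volume.restrict (tsupport φ)) := ⟨by simpa using hK.measure_lt_top⟩
  rw [ofReal_integral_eq_lintegral_ofReal (integrable_area
    ((memLp_restrict_of_bounded measurable_coneGrad abs_coneGrad_le_one hK 1).integrable le_rfl)
    ((memLp_coneVariation hφ).integrable (by norm_num))
    ((memLp_coneVariation_sq hφ).integrable (by norm_num)) ε)
    (Eventually.of_forall fun p => Real.sqrt_nonneg _)]
  refine lintegral_congr_ae (ae_restrict_of_ae ?_)
  filter_upwards [intrinsicGradient_coneFun_add hφ ε] with p hp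
  rw [hp]

lemma toReal_areaAlong_coneFun (hφ : IsTestFunction univ φ) (ε : ℝ) :
    (areaAlong univ coneFun φ ε).toReal = ∫ p in tsupport φ,
      √(1 + (coneGrad p + ε * coneVariation φ p + ε ^ 2 * (φ p * fderiv ℝ φ p (0, 1))) ^ 2) := by
  rw [areaAlong_coneFun hφ, ENNReal.toReal_ofReal (integral_nonneg fun p => Real.sqrt_nonneg _)]

/-- Integration by parts moves `∂_y + f ∂_t` onto `u = unitSlope ∘ coneGrad`. The term `f_t φ` of
the variation cancels the divergence of `(1, f)`, leaving `-φ (u_y + f u_t) = 0`. -/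
lemma integral_coneSlope_mul_coneVariation (hφ : IsTestFunction univ φ) :
    ∫ p, unitSlope (coneGrad p) * coneVariation φ p = 0 := by
  have h1 := integral_partialFst_mul_test continuousOn_coneSlope hasPartialFst_coneSlope
    locallyIntegrable_coneSlope locallyIntegrable_coneFun_mul_coneSlopeSnd.neg hφ
  have l3 : LocallyIntegrable fun p => coneSlopeSnd p * coneFun p +
      unitSlope (coneGrad p) * coneFunSnd p := by
    have := locallyIntegrable_coneFun_mul_coneSlopeSnd.add
      locallyIntegrable_coneSlope_mul_coneFunSnd
    refine this.congr (Eventually.of_forall fun p => ?_)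
    simp only [Pi.add_apply]
    ring
  have h2 : ∫ p, unitSlope (coneGrad p) * coneFun p * fderiv ℝ φ p (0, 1) =
      -∫ p, (coneSlopeSnd p * coneFun p + unitSlope (coneGrad p) * coneFunSnd p) * φ p :=
    integral_partialSnd_mul_test
    (continuousOn_coneSlope.mul continuous_coneFun.continuousOn)
    (fun p hp => (hasPartialSnd_coneSlope p hp).mul (hasPartialSnd_coneFun p hp))
    locallyIntegrable_coneSlope_mul_coneFun l3 hφ
  have i1 := locallyIntegrable_coneSlope.integrable_mul_test (hφ.fderiv_apply (1, 0)).continuous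
    (hφ.fderiv_apply (1, 0)).hasCompactSupport
  have i2 := locallyIntegrable_coneSlope_mul_coneFun.integrable_mul_test
    (hφ.fderiv_apply (0, 1)).continuous (hφ.fderiv_apply (0, 1)).hasCompactSupport
  have i3 := locallyIntegrable_coneSlope_mul_coneFunSnd.integrable_mul_test hφ.continuous
    hφ.hasCompactSupport
  have i4 := locallyIntegrable_coneFun_mul_coneSlopeSnd.integrable_mul_test hφ.continuous
    hφ.hasCompactSupport
  have e1 : ∫ p, unitSlope (coneGrad p) * coneVariation φ p =
      ∫ p, (unitSlope (coneGrad p) * fderiv ℝ φ p (1, 0) +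
        unitSlope (coneGrad p) * coneFun p * fderiv ℝ φ p (0, 1) +
        unitSlope (coneGrad p) * coneFunSnd p * φ p) := by
    congr 1 with p
    rw [coneVariation]
    ring
  have e2 : ∫ p, (coneSlopeSnd p * coneFun p + unitSlope (coneGrad p) * coneFunSnd p) * φ p =
      ∫ p, (coneFun p * coneSlopeSnd p * φ p + unitSlope (coneGrad p) * coneFunSnd p * φ p) := by
    congr 1 with p
    ring
  have e3 : ∫ p, -(coneFun p * coneSlopeSnd p) * φ p =
      -∫ p, coneFun p * coneSlopeSnd p * φ p := by
    rw [← integral_neg]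
    congr 1 with p
    simp
  rw [integral_add i4 i3] at e2
  rw [e2] at h2
  rw [e3] at h1
  rw [e1, integral_add (by exact i1.add i2) i3, integral_add i1 i2, h1, h2]
  ring

lemma integral_coneSlope_mul_sq (hφ : IsTestFunction univ φ) :
    ∫ p, 2 * (unitSlope (coneGrad p) * (φ p * fderiv ℝ φ p (0, 1))) =
      -∫ p, coneSlopeSnd p * (φ p * φ p) := by
  have h := integral_partialSnd_mul_test continuousOn_coneSlope hasPartialSnd_coneSlope
    locallyIntegrable_coneSlope locallyIntegrable_coneSlopeSnd (hφ.mul_contDiff hφ.contDiff)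
  rw [← h]
  congr 1 with p
  rw [fderiv_fun_mul (hφ.differentiable p) (hφ.differentiable p)]
  simp
  ring

/-- The weak form of `w_y + (f w)_t = 0` for `w = ∂_t u`, where `u = unitSlope ∘ coneGrad`. As `w`
jumps, it is not differentiated: since `u_y = -f w`, one integrates `u ψ_{yt}` by parts in `y` and
in `t` and compares. -/
lemma integral_coneSlopeSnd_mul_jacobian {ψ : ℝ × ℝ → ℝ} (hψ : IsTestFunction univ ψ) :
    ∫ p, coneSlopeSnd p * (fderiv ℝ ψ p (1, 0) + coneFun p * fderiv ℝ ψ p (0, 1)) = 0 := by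
  have h1 := integral_partialFst_mul_test continuousOn_coneSlope hasPartialFst_coneSlope
    locallyIntegrable_coneSlope locallyIntegrable_coneFun_mul_coneSlopeSnd.neg
    (hψ.fderiv_apply (0, 1))
  have h2 := integral_partialSnd_mul_test continuousOn_coneSlope hasPartialSnd_coneSlope
    locallyIntegrable_coneSlope locallyIntegrable_coneSlopeSnd (hψ.fderiv_apply (1, 0))
  have hsymm : ∀ p, fderiv ℝ (fun p => fderiv ℝ ψ p (0, 1)) p (1, 0) =
      fderiv ℝ (fun p => fderiv ℝ ψ p (1, 0)) p (0, 1) := by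
    intro p
    have hd : DifferentiableAt ℝ (fderiv ℝ ψ) p :=
      ((hψ.contDiff.fderiv_right (m := 1) (by norm_cast)).differentiable one_ne_zero) p
    rw [fderiv_clm_apply hd (differentiableAt_const _),
      fderiv_clm_apply hd (differentiableAt_const _)]
    have := (hψ.contDiff.contDiffAt (x := p)).isSymmSndFDerivAt (by
      simp only [minSmoothness_of_isRCLikeNormedField]
      exact WithTop.coe_le_coe.2 (le_top (a := (2 : ℕ∞))))
    simpa using this (1, 0) (0, 1)
  have i1 := locallyIntegrable_coneSlopeSnd.integrable_mul_test
    (hψ.fderiv_apply (1, 0)).continuous (hψ.fderiv_apply (1, 0)).hasCompactSupport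
  have i2 := locallyIntegrable_coneFun_mul_coneSlopeSnd.integrable_mul_test
    (hψ.fderiv_apply (0, 1)).continuous (hψ.fderiv_apply (0, 1)).hasCompactSupport
  have e3 : ∫ p, -(coneFun p * coneSlopeSnd p) * fderiv ℝ ψ p (0, 1) =
      -∫ p, coneFun p * coneSlopeSnd p * fderiv ℝ ψ p (0, 1) := by
    rw [← integral_neg]
    congr 1 with p
    simp
  have e4 : ∫ p, coneSlopeSnd p * (fderiv ℝ ψ p (1, 0) + coneFun p * fderiv ℝ ψ p (0, 1)) =
      ∫ p, (coneSlopeSnd p * fderiv ℝ ψ p (1, 0) +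
        coneFun p * coneSlopeSnd p * fderiv ℝ ψ p (0, 1)) := by
    congr 1 with p
    ring
  simp only [hsymm] at h1
  rw [e3, h2] at h1
  rw [e4, integral_add i1 i2]
  linarith

lemma second_variation_integrand_nonneg (φ : ℝ × ℝ → ℝ) (p : ℝ × ℝ) :
    0 ≤ slopeDensity (coneGrad p) * coneVariation φ p ^ 2 - coneSlopeSnd p * (φ p * φ p) -
      coneSlopeSnd p * (φ p * φ p + 2 * p.1 * φ p *
        (fderiv ℝ φ p (1, 0) + coneFun p * fderiv ℝ φ p (0, 1))) := by
  set D := fderiv ℝ φ p (1, 0) + coneFun p * fderiv ℝ φ p (0, 1) with hD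
  have hk := slopeDensity_nonneg (coneGrad p)
  have ha : coneVariation φ p = D + p.1 * coneGradSnd p * φ p := rfl
  rw [ha, coneSlopeSnd]
  set k := slopeDensity (coneGrad p)
  have hcases : coneGradSnd p = 0 ∨ (p.1 ≠ 0 ∧ coneGradSnd p = 2 / p.1 ^ 2) := by
    rw [coneGradSnd]
    split_ifs with h
    · right
      refine ⟨fun hy => ?_, rfl⟩
      rw [hy] at h; norm_num at h; linarith
    · exact Or.inl rfl
  rcases hcases with h | ⟨h0, h⟩
  · rw [h]; simp; positivity
  · rw [h]
    -- On the sector `f_t = 2/y` and `g_t = 2/y²`: the cross terms `4Dφ/y` cancel, and so do the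
    -- terms `4φ²/y²`.
    have : k * (D + p.1 * (2 / p.1 ^ 2) * φ p) ^ 2 - k * (2 / p.1 ^ 2) * (φ p * φ p) -
        k * (2 / p.1 ^ 2) * (φ p * φ p + 2 * p.1 * φ p * D) = k * D ^ 2 := by
      field_simp
      ring
    rw [this]
    positivity

lemma second_variation_nonneg (hφ : IsTestFunction univ φ) :
    0 ≤ ∫ p in tsupport φ, slopeDensity (coneGrad p) * coneVariation φ p ^ 2 +
      2 * (unitSlope (coneGrad p) * (φ p * fderiv ℝ φ p (0, 1))) := by
  have hK : IsCompact (tsupport φ) := hφ.hasCompactSupport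
  have : IsFiniteMeasure (volume.restrict (tsupport φ)) := ⟨by simpa using hK.measure_lt_top⟩
  have hφ2 := hφ.mul_contDiff hφ.contDiff
  -- The test function `y φ²` gives the null integral of `w (φ² + 2yφ (φ_y + f φ_t))`, exactly what
  -- completes the square.
  have hψ := hφ2.mul_contDiff (ψ := fun p : ℝ × ℝ => p.1) contDiff_fst
  have hJ := integral_coneSlopeSnd_mul_jacobian hψ
  have hψd : ∀ p v, fderiv ℝ (fun p : ℝ × ℝ => p.1 * (φ p * φ p)) p v =
      v.1 * (φ p * φ p) + 2 * p.1 * φ p * fderiv ℝ φ p v := by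
    intro p v
    rw [fderiv_fun_mul differentiableAt_fst
      (by exact (hφ.differentiable p).mul (hφ.differentiable p)),
      fderiv_fun_mul (hφ.differentiable p) (hφ.differentiable p), fderiv_fst]
    simp
    ring
  have iJ : Integrable fun p => coneSlopeSnd p * (φ p * φ p + 2 * p.1 * φ p *
      (fderiv ℝ φ p (1, 0) + coneFun p * fderiv ℝ φ p (0, 1))) := by
    refine locallyIntegrable_coneSlopeSnd.integrable_mul_test ?_ ?_
    · exact (hφ.continuous.mul hφ.continuous).add (((continuous_const.mul continuous_fst).mul
        hφ.continuous).mul ((hφ.fderiv_apply _).continuous.add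
          (continuous_coneFun.mul (hφ.fderiv_apply _).continuous)))
    · exact hφ2.hasCompactSupport.add (hφ.hasCompactSupport.mul_left.mul_right)
  have eJ : ∫ p, coneSlopeSnd p * (φ p * φ p + 2 * p.1 * φ p *
      (fderiv ℝ φ p (1, 0) + coneFun p * fderiv ℝ φ p (0, 1))) = 0 := by
    refine Eq.trans ?_ hJ
    congr 1 with p
    rw [hψd, hψd]
    ring
  have i1 : Integrable fun p => slopeDensity (coneGrad p) * coneVariation φ p ^ 2 := by
    -- Taking `b = 0` isolates the integrability of the quadratic term.
    have := (hasDerivAt_area_deriv (g := coneGrad) measurable_coneGrad.aestronglyMeasurable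
      (memLp_coneVariation hφ) (b := 0) (MemLp.zero' )).1
    simp only [Pi.zero_apply, mul_zero, add_zero] at this
    refine (integrableOn_iff_integrable_of_support_subset fun p hp => ?_).1 this
    by_contra h
    exact hp (by simp [coneVariation_eq_zero h])
  have i2 : Integrable fun p => 2 * (unitSlope (coneGrad p) * (φ p * fderiv ℝ φ p (0, 1))) :=
    (locallyIntegrable_coneSlope.integrable_mul_test (φ := fun p => φ p * fderiv ℝ φ p (0, 1))
      (hφ.continuous.mul (hφ.fderiv_apply _).continuous)
      hφ.hasCompactSupport.mul_right).const_mul 2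
  have i3 := locallyIntegrable_coneSlopeSnd.integrable_mul_test hφ2.continuous
    hφ2.hasCompactSupport
  rw [setIntegral_eq_integral_of_forall_compl_eq_zero fun p hp => by
    simp [coneVariation_eq_zero hp, image_eq_zero_of_notMem_tsupport hp]]
  rw [integral_add i1 i2, integral_coneSlope_mul_sq hφ, ← sub_eq_add_neg, ← integral_sub i1 i3]
  have h : 0 ≤ ∫ p, (slopeDensity (coneGrad p) * coneVariation φ p ^ 2 -
      coneSlopeSnd p * (φ p * φ p) - coneSlopeSnd p * (φ p * φ p + 2 * p.1 * φ p *
        (fderiv ℝ φ p (1, 0) + coneFun p * fderiv ℝ φ p (0, 1)))) :=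
    integral_nonneg fun p => second_variation_integrand_nonneg φ p
  rwa [integral_sub (by exact i1.sub i3) iJ, eJ, sub_zero] at h

lemma isStableGraph_coneFun : IsStableGraph univ coneFun := by
  have hderiv : ∀ φ : ℝ × ℝ → ℝ, IsTestFunction univ φ → ∀ ε : ℝ,
      HasDerivAt (fun e => (areaAlong univ coneFun φ e).toReal)
      (∫ p in tsupport φ, unitSlope (coneGrad p + ε * coneVariation φ p +
        ε ^ 2 * (φ p * fderiv ℝ φ p (0, 1))) *
        (coneVariation φ p + 2 * ε * (φ p * fderiv ℝ φ p (0, 1)))) ε := by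
    intro φ hφ ε
    have hK : IsCompact (tsupport φ) := hφ.hasCompactSupport
    have : IsFiniteMeasure (volume.restrict (tsupport φ)) := ⟨by simpa using hK.measure_lt_top⟩
    simp only [toReal_areaAlong_coneFun hφ]
    exact hasDerivAt_area
      ((memLp_restrict_of_bounded measurable_coneGrad abs_coneGrad_le_one hK 1).integrable le_rfl)
      ((memLp_coneVariation hφ).integrable (by norm_num))
      ((memLp_coneVariation_sq hφ).integrable (by norm_num)) ε
  refine ⟨⟨memW1pLoc_coneFun le_rfl (by norm_num), fun φ hφ => ⟨Eventually.of_forall fun ε => ?_,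
    ?_⟩⟩, fun φ hφ => ?_⟩
  · rw [areaAlong_coneFun hφ]
    exact ENNReal.ofReal_lt_top
  · have h := hderiv φ hφ 0
    refine h.congr_deriv ?_
    refine Eq.trans ?_ (integral_coneSlope_mul_coneVariation hφ)
    rw [setIntegral_eq_integral_of_forall_compl_eq_zero fun p hp => by
      simp [coneVariation_eq_zero hp]]
    simp
  · have hK : IsCompact (tsupport φ) := hφ.hasCompactSupport
    have : IsFiniteMeasure (volume.restrict (tsupport φ)) := ⟨by simpa using hK.measure_lt_top⟩
    exact ⟨_, _, second_variation_nonneg hφ, Eventually.of_forall (hderiv φ hφ),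
      (hasDerivAt_area_deriv measurable_coneGrad.aestronglyMeasurable (memLp_coneVariation hφ)
        (memLp_coneVariation_sq hφ)).2⟩

end Stability

/-! ### Intrinsic coordinates adapted to the cone -/

/-- The coordinates `(p, s) ↦ (0, y, t) (f(y,t) + s, 0, 0)` with `p = (y, t)` and `f = coneFun`, in
which the intrinsic graph of `f` is the plane `s = 0`. -/
noncomputable def coneChart : (ℝ × ℝ) × ℝ ≃ₜ Heis where
  toFun w := (coneFun w.1 + w.2, w.1.1, w.1.2 - (coneFun w.1 + w.2) * w.1.1 / 2)
  invFun q := ((q.2.1, q.2.2 + q.1 * q.2.1 / 2), q.1 - coneFun (q.2.1, q.2.2 + q.1 * q.2.1 / 2))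
  left_inv w := by simp
  right_inv q := by simp
  continuous_toFun := by
    have := continuous_coneFun
    fun_prop
  continuous_invFun := by
    have := continuous_coneFun
    fun_prop

lemma coneChart_apply (p : ℝ × ℝ) (s : ℝ) :
    coneChart (p, s) = (coneFun p + s, p.1, p.2 - (coneFun p + s) * p.1 / 2) := rfl

/-- Up to reordering coordinates the chart is a composite of shears, each a translation in one
variable by a function of the others. -/
lemma measurePreserving_coneChart : MeasurePreserving coneChart := by
  have h1 : MeasurePreserving (fun w : (ℝ × ℝ) × ℝ => (w.1, coneFun w.1 + w.2)) := by
    refine (MeasurePreserving.id volume).skew_product (g := fun p s => coneFun p + s) ?_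
      (Eventually.of_forall fun p => map_add_left_eq_self volume (coneFun p))
    exact ((continuous_coneFun.comp continuous_fst).add continuous_snd).measurable
  have h2 : MeasurePreserving (fun w : ℝ × (ℝ × ℝ) =>
      (w.1, (w.2.1, w.2.2 - w.1 * w.2.1 / 2))) := by
    refine (MeasurePreserving.id (volume : Measure ℝ)).skew_product
      (g := fun x (p : ℝ × ℝ) => (p.1, p.2 - x * p.1 / 2)) ?_ (Eventually.of_forall fun x => ?_)
    · exact (by fun_prop : Continuous fun w : ℝ × (ℝ × ℝ) =>
        (w.2.1, w.2.2 - w.1 * w.2.1 / 2)).measurable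
    · refine MeasurePreserving.map_eq (μb := volume) ?_
      refine (MeasurePreserving.id (volume : Measure ℝ)).skew_product
        (g := fun y t => t - x * y / 2) ?_
        (Eventually.of_forall fun y => ?_)
      · exact (by fun_prop : Continuous fun w : ℝ × ℝ => w.2 - x * w.1 / 2).measurable
      · exact (measurePreserving_sub_right volume (x * y / 2)).map_eq
  exact h2.comp (Measure.measurePreserving_swap.comp h1)

lemma preimage_intrinsicSubgraph_coneChart :
    coneChart ⁻¹' intrinsicSubgraph univ coneFun = univ ×ˢ Iic 0 := by
  ext ⟨p, s⟩
  simp [mem_intrinsicSubgraph_iff, coneChart_apply]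

lemma isClosed_intrinsicSubgraph_coneFun : IsClosed (intrinsicSubgraph univ coneFun) := by
  have : intrinsicSubgraph univ coneFun =
      {q : Heis | q.1 ≤ coneFun (q.2.1, q.2.2 + q.1 * q.2.1 / 2)} := by
    ext q
    exact mem_intrinsicSubgraph_iff
  rw [this]
  exact isClosed_le continuous_fst (continuous_coneFun.comp (by fun_prop))

section Green

variable {Ω : Set Heis} {ψ ψ₁ ψ₂ : Heis → ℝ}

lemma IsTestFunction.continuous_fderiv_apply (hψ : IsTestFunction Ω ψ) {v : Heis → Heis}
    (hv : Continuous v) : Continuous fun q => fderiv ℝ ψ q (v q) :=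
  (hψ.contDiff.continuous_fderiv (by simp)).clm_apply hv

lemma IsTestFunction.hasCompactSupport_fderiv_apply (hψ : IsTestFunction Ω ψ)
    (v : Heis → Heis) : HasCompactSupport fun q => fderiv ℝ ψ q (v q) :=
  (hψ.hasCompactSupport.fderiv (𝕜 := ℝ)).mono fun q hq h => hq (by simp [h])

lemma continuous_heisX (hψ : IsTestFunction Ω ψ) : Continuous (heisX ψ) :=
  hψ.continuous_fderiv_apply (by fun_prop)

lemma continuous_heisY (hψ : IsTestFunction Ω ψ) : Continuous (heisY ψ) :=
  hψ.continuous_fderiv_apply (by fun_prop)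

lemma hasCompactSupport_heisX (hψ : IsTestFunction Ω ψ) : HasCompactSupport (heisX ψ) :=
  hψ.hasCompactSupport_fderiv_apply _

lemma hasCompactSupport_heisY (hψ : IsTestFunction Ω ψ) : HasCompactSupport (heisY ψ) :=
  hψ.hasCompactSupport_fderiv_apply _

lemma HasCompactSupport.comp_coneChart_left {h : Heis → ℝ} (hs : HasCompactSupport h) (s : ℝ) :
    HasCompactSupport fun p => h (coneChart (p, s)) :=
  hs.comp_isClosedEmbedding (coneChart.isClosedEmbedding.comp (isClosedEmbedding_prodMkRight s))

lemma HasCompactSupport.comp_coneChart_right {h : Heis → ℝ} (hs : HasCompactSupport h)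
    (p : ℝ × ℝ) : HasCompactSupport fun s => h (coneChart (p, s)) :=
  hs.comp_isClosedEmbedding (coneChart.isClosedEmbedding.comp (isClosedEmbedding_prodMkLeft p))

/-- Varying `s` is right multiplication by `(s, 0, 0)`, whose generator is the left-invariant field
`X`; so `X` is `∂_s` in the chart. -/
lemma hasDerivAt_comp_coneChart (hψ : IsTestFunction Ω ψ) (p : ℝ × ℝ) (s : ℝ) :
    HasDerivAt (fun s => ψ (coneChart (p, s))) (heisX ψ (coneChart (p, s))) s := by
  have hc : HasDerivAt (fun s => coneChart (p, s)) (1, 0, -(p.1 / 2)) s := by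
    have h1 : HasDerivAt (fun s => coneFun p + s) 1 s := (hasDerivAt_id s).const_add _
    refine h1.prodMk ((hasDerivAt_const s p.1).prodMk ?_)
    refine (((h1.mul_const p.1).div_const 2).const_sub p.2).congr_deriv (by ring)
  exact (hψ.differentiable _).hasFDerivAt.comp_hasDerivAt s hc

lemma hasPartialFst_comp_coneChart (hψ : IsTestFunction Ω ψ) (s : ℝ) :
    HasPartialFst (fun p => ψ (coneChart (p, s))) fun p =>
      coneFunFst p * heisX ψ (coneChart (p, s)) + (heisY ψ (coneChart (p, s)) -
        (coneFun p + s) * fderiv ℝ ψ (coneChart (p, s)) (0, 0, 1)) := by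
  intro p hp
  have hc : HasDerivAt (fun y => coneChart ((y, p.2), s)) (coneFunFst p, 1,
      -((coneFunFst p * p.1 + (coneFun p + s)) / 2)) p.1 := by
    have h1 : HasDerivAt (fun y => coneFun (y, p.2) + s) (coneFunFst p) p.1 :=
      (hasPartialFst_coneFun p hp).add_const s
    refine h1.prodMk ((hasDerivAt_id p.1).prodMk ?_)
    refine (((h1.mul (hasDerivAt_id p.1)).div_const 2).const_sub p.2).congr_deriv ?_
    simp
  refine ((hψ.differentiable _).hasFDerivAt.comp_hasDerivAt p.1 hc).congr_deriv ?_
  -- With `x = f + s`, the tangent vector is split as `f_y X + Y - x ∂_z`.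
  have hv : ((coneFunFst p, 1, -((coneFunFst p * p.1 + (coneFun p + s)) / 2)) : Heis) =
      coneFunFst p • (1, 0, -(p.1 / 2)) + ((0, 1, (coneFun p + s) / 2) -
        (coneFun p + s) • (0, 0, 1)) := by
    ext <;> simp
    ring
  rw [hv, map_add, map_sub, map_smul, map_smul]
  rfl

lemma hasPartialSnd_comp_coneChart (hψ : IsTestFunction Ω ψ) (s : ℝ) :
    HasPartialSnd (fun p => ψ (coneChart (p, s))) fun p =>
      coneFunSnd p * heisX ψ (coneChart (p, s)) + fderiv ℝ ψ (coneChart (p, s)) (0, 0, 1) := by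
  intro p hp
  have hc : HasDerivAt (fun t => coneChart ((p.1, t), s)) (coneFunSnd p, 0,
      1 - coneFunSnd p * p.1 / 2) p.2 := by
    have h1 : HasDerivAt (fun t => coneFun (p.1, t) + s) (coneFunSnd p) p.2 :=
      (hasPartialSnd_coneFun p hp).add_const s
    exact h1.prodMk ((hasDerivAt_const p.2 p.1).prodMk
      ((hasDerivAt_id p.2).sub ((h1.mul_const p.1).div_const 2)))
  refine ((hψ.differentiable _).hasFDerivAt.comp_hasDerivAt p.2 hc).congr_deriv ?_
  have hv : ((coneFunSnd p, 0, 1 - coneFunSnd p * p.1 / 2) : Heis) =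
      coneFunSnd p • (1, 0, -(p.1 / 2)) + (0, 0, 1) := by
    ext <;> simp
    ring
  rw [hv, map_add, map_smul]
  rfl

/-- The integrand of `integral_slice_eq_zero`. -/
noncomputable def sliceDivergence (ψ : Heis → ℝ) (w : (ℝ × ℝ) × ℝ) : ℝ :=
  heisY ψ (coneChart w) + coneGrad w.1 * heisX ψ (coneChart w) +
    coneFunSnd w.1 * (ψ (coneChart w) + w.2 * heisX ψ (coneChart w))

/-- For `Ψ = ψ ∘ coneChart`, the integrand is the planar divergence `∂_y Ψ + ∂_t ((f + s) Ψ)`; the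
`∂_z ψ` contributions of the two terms cancel. -/
lemma integral_slice_eq_zero (hψ : IsTestFunction Ω ψ) (s : ℝ) :
    ∫ p, sliceDivergence ψ (p, s) = 0 := by
  have hchart : Continuous fun p => coneChart (p, s) := coneChart.continuous.comp (by fun_prop)
  have hs : Continuous fun p => coneFun p + s := continuous_coneFun.add continuous_const
  have cX := (continuous_heisX hψ).comp hchart
  have cY := (continuous_heisY hψ).comp hchart
  have cZ := (hψ.continuous_fderiv_apply (v := fun _ => (0, 0, 1)) continuous_const).comp hchart
  have cψ := hψ.continuous.comp hchart
  have sX := (hasCompactSupport_heisX hψ).comp_coneChart_left s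
  have sY := (hasCompactSupport_heisY hψ).comp_coneChart_left s
  have sZ := (hψ.hasCompactSupport_fderiv_apply fun _ => (0, 0, 1)).comp_coneChart_left s
  have sψ := hψ.hasCompactSupport.comp_coneChart_left s
  have i1 : Integrable fun p => coneFunFst p * heisX ψ (coneChart (p, s)) +
      (heisY ψ (coneChart (p, s)) -
        (coneFun p + s) * fderiv ℝ ψ (coneChart (p, s)) (0, 0, 1)) := by
    refine Integrable.add ?_ (Continuous.integrable_of_hasCompactSupport (cY.sub (hs.mul cZ))
      (sY.sub sZ.mul_left))
    exact (locallyIntegrable_of_bounded measurable_coneFunFst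
      abs_coneFunFst_le).integrable_mul_test cX sX
  have i2 : Integrable fun p => coneFunSnd p * ψ (coneChart (p, s)) + (coneFun p + s) *
      (coneFunSnd p * heisX ψ (coneChart (p, s)) +
        fderiv ℝ ψ (coneChart (p, s)) (0, 0, 1)) := by
    have h1 := locallyIntegrable_coneFunSnd.integrable_mul_test
      (φ := fun p => ψ (coneChart (p, s)) + (coneFun p + s) * heisX ψ (coneChart (p, s)))
      (cψ.add (hs.mul cX)) (sψ.add sX.mul_left)
    have h2 : Integrable fun p => (coneFun p + s) * fderiv ℝ ψ (coneChart (p, s)) (0, 0, 1) :=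
      Continuous.integrable_of_hasCompactSupport (hs.mul cZ) sZ.mul_left
    refine (h1.add h2).congr (Eventually.of_forall fun p => ?_)
    simp only [Pi.add_apply]
    ring
  have e1 := integral_partialFst_eq_zero cψ.continuousOn sψ (hasPartialFst_comp_coneChart hψ s) i1
  have e2 := integral_partialSnd_eq_zero
    (G := fun p => (coneFun p + s) * ψ (coneChart (p, s)))
    (hs.mul cψ).continuousOn sψ.mul_left
    (fun p hp => ((hasPartialSnd_coneFun p hp).add_const s).mul
      (hasPartialSnd_comp_coneChart hψ s p hp)) i2
  have e3 := integral_add i1 i2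
  rw [e1, e2, add_zero] at e3
  rw [← e3]
  congr 1 with p
  simp only [sliceDivergence, coneFunFst]
  ring

lemma locallyIntegrable_comp_fst {F : ℝ × ℝ → ℝ} (hF : LocallyIntegrable F) :
    LocallyIntegrable fun w : (ℝ × ℝ) × ℝ => F w.1 := by
  refine locallyIntegrable_iff.2 fun K hK => ?_
  have h1 : IsCompact (Prod.fst '' K) := hK.image continuous_fst
  have h2 : IsCompact (Prod.snd '' K) := hK.image continuous_snd
  have : IsFiniteMeasure ((volume : Measure ℝ).restrict (Prod.snd '' K)) :=
    ⟨by simpa using h2.measure_lt_top⟩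
  have h := (locallyIntegrable_iff.1 hF _ h1).comp_fst (volume.restrict (Prod.snd '' K))
  rw [Measure.prod_restrict] at h
  exact IntegrableOn.mono_set h fun w hw => ⟨mem_image_of_mem _ hw, mem_image_of_mem _ hw⟩

lemma integral_Iic_heisX_comp_coneChart (hψ : IsTestFunction Ω ψ) (p : ℝ × ℝ) :
    ∫ s in Iic 0, heisX ψ (coneChart (p, s)) = ψ (coneChart (p, 0)) := by
  have hc : ContDiff ℝ 1 fun s => ψ (coneChart (p, s)) := by
    refine (hψ.contDiff.of_le (by simp)).comp ?_
    simp only [coneChart_apply]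
    fun_prop
  rw [← HasCompactSupport.integral_Iic_deriv_eq hc (hψ.hasCompactSupport.comp_coneChart_right p)]
  simp only [(hasDerivAt_comp_coneChart hψ p _).deriv]

/-- The integrand is `∂_s (s ψ)` and `s ψ` vanishes at `s = 0`. This removes the unbounded
coefficient `f_t` from the Gauss–Green formula. -/
lemma integral_Iic_mul_heisX_comp_coneChart (hψ : IsTestFunction Ω ψ) (p : ℝ × ℝ) :
    ∫ s in Iic 0, (ψ (coneChart (p, s)) + s * heisX ψ (coneChart (p, s))) = 0 := by
  have hc : ContDiff ℝ 1 fun s => s * ψ (coneChart (p, s)) := by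
    refine contDiff_id.mul ((hψ.contDiff.of_le (by simp)).comp ?_)
    simp only [coneChart_apply]
    fun_prop
  have hd : ∀ s, HasDerivAt (fun s => s * ψ (coneChart (p, s)))
      (ψ (coneChart (p, s)) + s * heisX ψ (coneChart (p, s))) s := fun s => by
    simpa using (hasDerivAt_id s).fun_mul (hasDerivAt_comp_coneChart hψ p s)
  have := HasCompactSupport.integral_Iic_deriv_eq hc
    (hψ.hasCompactSupport.comp_coneChart_right p).mul_left 0
  simpa only [(hd _).deriv, zero_mul] using this

lemma restrict_univ_prod_Iic :
    (volume : Measure ((ℝ × ℝ) × ℝ)).restrict (univ ×ˢ Iic 0) =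
      (volume : Measure (ℝ × ℝ)).prod ((volume : Measure ℝ).restrict (Iic 0)) := by
  rw [Measure.volume_eq_prod (ℝ × ℝ) ℝ, ← Measure.prod_restrict, Measure.restrict_univ]

lemma setIntegral_intrinsicSubgraph_coneFun {h : Heis → ℝ} (hc : Continuous h)
    (hs : HasCompactSupport h) :
    Integrable (fun w => h (coneChart w)) ((volume : Measure (ℝ × ℝ)).prod
      ((volume : Measure ℝ).restrict (Iic 0))) ∧
    ∫ q in intrinsicSubgraph univ coneFun, h q =
      ∫ w, h (coneChart w) ∂((volume : Measure (ℝ × ℝ)).prod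
        ((volume : Measure ℝ).restrict (Iic 0))) := by
  have hi : Integrable (fun w => h (coneChart w)) :=
    Continuous.integrable_of_hasCompactSupport (hc.comp coneChart.continuous)
      (hs.comp_isClosedEmbedding coneChart.isClosedEmbedding)
  rw [← restrict_univ_prod_Iic, ← preimage_intrinsicSubgraph_coneChart]
  refine ⟨hi.integrableOn, ?_⟩
  rw [measurePreserving_coneChart.setIntegral_preimage_emb
    coneChart.measurableEmbedding]

/-- The Gauss–Green formula for the subgraph of `coneFun`. -/
lemma setIntegral_intrinsicSubgraph_divergence (h₁ : IsTestFunction Ω ψ₁)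
    (h₂ : IsTestFunction Ω ψ₂) :
    ∫ q in intrinsicSubgraph univ coneFun, (heisX ψ₁ q + heisY ψ₂ q) =
      ∫ p, (ψ₁ (coneChart (p, 0)) - coneGrad p * ψ₂ (coneChart (p, 0))) := by
  obtain ⟨iX, eX⟩ := setIntegral_intrinsicSubgraph_coneFun (continuous_heisX h₁)
    (hasCompactSupport_heisX h₁)
  obtain ⟨iY, eY⟩ := setIntegral_intrinsicSubgraph_coneFun (continuous_heisY h₂)
    (hasCompactSupport_heisY h₂)
  have hchart : Continuous fun p => coneChart (p, 0) := coneChart.continuous.comp (by fun_prop)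
  have hleX : IntegrableOn (heisX ψ₁) (intrinsicSubgraph univ coneFun) :=
    ((continuous_heisX h₁).integrable_of_hasCompactSupport
      (hasCompactSupport_heisX h₁)).integrableOn
  have hleY : IntegrableOn (heisY ψ₂) (intrinsicSubgraph univ coneFun) :=
    ((continuous_heisY h₂).integrable_of_hasCompactSupport
      (hasCompactSupport_heisY h₂)).integrableOn
  have hres : (volume : Measure (ℝ × ℝ)).prod ((volume : Measure ℝ).restrict (Iic 0)) ≤
      (volume : Measure ((ℝ × ℝ) × ℝ)) := by
    rw [← restrict_univ_prod_Iic]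
    exact Measure.restrict_le_self
  have cX2 := (continuous_heisX h₂).comp coneChart.continuous
  have sX2 := (hasCompactSupport_heisX h₂).comp_isClosedEmbedding coneChart.isClosedEmbedding
  have cψ2 := h₂.continuous.comp coneChart.continuous
  have sψ2 := h₂.hasCompactSupport.comp_isClosedEmbedding coneChart.isClosedEmbedding
  have iG : Integrable (fun w : (ℝ × ℝ) × ℝ => coneGrad w.1 * heisX ψ₂ (coneChart w))
      ((volume : Measure (ℝ × ℝ)).prod ((volume : Measure ℝ).restrict (Iic 0))) := by
    have := (locallyIntegrable_comp_fst (locallyIntegrable_of_bounded measurable_coneGrad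
      abs_coneGrad_le_one)).integrable_smul_left_of_hasCompactSupport cX2 sX2
    simpa [mul_comm] using this.mono_measure hres
  have iT : Integrable (fun w : (ℝ × ℝ) × ℝ =>
      coneFunSnd w.1 * (ψ₂ (coneChart w) + w.2 * heisX ψ₂ (coneChart w)))
      ((volume : Measure (ℝ × ℝ)).prod ((volume : Measure ℝ).restrict (Iic 0))) := by
    have := (locallyIntegrable_comp_fst
      locallyIntegrable_coneFunSnd).integrable_smul_left_of_hasCompactSupport
      (cψ2.add (continuous_snd.mul cX2)) (sψ2.add sX2.mul_left)
    simpa [mul_comm] using this.mono_measure hres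
  have eG : ∫ w, coneGrad w.1 * heisX ψ₂ (coneChart w)
      ∂((volume : Measure (ℝ × ℝ)).prod ((volume : Measure ℝ).restrict (Iic 0))) =
      ∫ p, coneGrad p * ψ₂ (coneChart (p, 0)) := by
    rw [integral_prod _ iG]
    congr 1 with p
    simp only [integral_const_mul, integral_Iic_heisX_comp_coneChart h₂]
  have eT : ∫ w, coneFunSnd w.1 * (ψ₂ (coneChart w) + w.2 * heisX ψ₂ (coneChart w))
      ∂((volume : Measure (ℝ × ℝ)).prod ((volume : Measure ℝ).restrict (Iic 0))) = 0 := by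
    rw [integral_prod _ iT]
    refine integral_eq_zero_of_ae (Eventually.of_forall fun p => ?_)
    simp only [integral_const_mul, integral_Iic_mul_heisX_comp_coneChart h₂, mul_zero,
      Pi.zero_apply]
  -- Integrating the slice identity over `s ≤ 0` expresses the integral of `Y ψ₂` through `eG` and
  -- `eT`, that is, through boundary values only.
  have eS : ∫ w, sliceDivergence ψ₂ w
      ∂((volume : Measure (ℝ × ℝ)).prod ((volume : Measure ℝ).restrict (Iic 0))) = 0 := by
    rw [integral_prod_symm _ (by exact (iY.add iG).add iT)]
    simp only [integral_slice_eq_zero h₂, integral_zero]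
  unfold sliceDivergence at eS
  rw [integral_add (by exact iY.add iG) iT, integral_add iY iG, eT, eG, ← eY] at eS
  have eX' : ∫ q in intrinsicSubgraph univ coneFun, heisX ψ₁ q = ∫ p, ψ₁ (coneChart (p, 0)) := by
    rw [eX, integral_prod _ iX]
    simp only [integral_Iic_heisX_comp_coneChart h₁]
  have j1 : Integrable fun p => ψ₁ (coneChart (p, 0)) :=
    (h₁.continuous.comp hchart).integrable_of_hasCompactSupport
      (h₁.hasCompactSupport.comp_coneChart_left 0)
  have j2 : Integrable fun p => coneGrad p * ψ₂ (coneChart (p, 0)) :=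
    (locallyIntegrable_of_bounded measurable_coneGrad abs_coneGrad_le_one).integrable_mul_test
      (h₂.continuous.comp hchart) (h₂.hasCompactSupport.comp_coneChart_left 0)
  rw [integral_add hleX hleY, eX', integral_sub j1 j2]
  linarith

end Green

/-! ### Calibrations -/

/-- The cutoff is `1` near each point of `K`, not merely on `K`, so that its derivatives drop out
there. -/
lemma exists_cutoff {K U : Set Heis} (hK : IsCompact K) (hU : IsOpen U) (hKU : K ⊆ U) :
    ∃ η : Heis → ℝ, IsTestFunction U η ∧ (∀ q, η q ∈ Icc (0 : ℝ) 1) ∧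
      ∀ q ∈ K, ∀ᶠ q' in 𝓝 q, η q' = 1 := by
  obtain ⟨L, hL, hKL, hLU⟩ := exists_compact_between hK hU hKU
  obtain ⟨η, h1, h0, h01⟩ := exists_contMDiffMap_one_nhds_of_subset_interior
    (modelWithCornersSelf ℝ Heis) (n := ⊤) hK.isClosed hKL
  have hsupp : tsupport η ⊆ L := closure_minimal
    (fun q hq => by_contra fun h => hq (h0 q h)) hL.isClosed
  exact ⟨η, ⟨η.contMDiff.contDiff, hL.of_isClosed_subset (isClosed_tsupport _) hsupp,
    hsupp.trans hLU⟩, h01, fun q hq => eventually_nhdsSet_iff_forall.1 h1 q hq⟩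

lemma IsTestFunction.mul_contDiffOn {U : Set Heis} {η a : Heis → ℝ} (hη : IsTestFunction U η)
    (hU : IsOpen U) (ha : ContDiffOn ℝ ((⊤ : ℕ∞) : WithTop ℕ∞) a U) :
    IsTestFunction U fun q => η q * a q where
  contDiff := by
    rw [contDiff_iff_contDiffAt]
    intro q
    by_cases hq : q ∈ tsupport η
    · exact hη.contDiff.contDiffAt.mul
        (ha.contDiffAt (hU.mem_nhds (hη.tsupport_subset hq)))
    · have : (fun q => η q * a q) =ᶠ[𝓝 q] fun _ => 0 := by
        filter_upwards [(isClosed_tsupport η).isOpen_compl.mem_nhds hq] with q' hq'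
        rw [image_eq_zero_of_notMem_tsupport hq', zero_mul]
      exact contDiffAt_const.congr_of_eventuallyEq this
  hasCompactSupport := hη.hasCompactSupport.mul_right
  tsupport_subset := (tsupport_mul_subset_left (f := η) (g := a)).trans hη.tsupport_subset

/-- Cauchy–Schwarz for `(u, v)` and `(1, -s)`. -/
lemma sub_mul_le_sqrt {u v : ℝ} (h : u ^ 2 + v ^ 2 ≤ 1) (s : ℝ) : u - s * v ≤ √(1 + s ^ 2) := by
  refine Real.le_sqrt_of_sq_le ?_
  nlinarith [sq_nonneg (s * u + v), mul_nonneg (sub_nonneg.2 h) (sq_nonneg s)]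

lemma sqrt_one_add_coneGrad_sq_le (p : ℝ × ℝ) : √(1 + coneGrad p ^ 2) ≤ 2 := by
  refine Real.sqrt_le_iff.2 ⟨by norm_num, ?_⟩
  nlinarith [coneGrad_nonneg p, coneGrad_le_one p]

lemma continuous_coneChart_zero : Continuous fun p => coneChart (p, 0) :=
  coneChart.continuous.comp (by fun_prop)

lemma integrable_boundary {Ω : Set Heis} {ψ₁ ψ₂ : Heis → ℝ} (h₁ : IsTestFunction Ω ψ₁)
    (h₂ : IsTestFunction Ω ψ₂) :
    Integrable fun p => ψ₁ (coneChart (p, 0)) - coneGrad p * ψ₂ (coneChart (p, 0)) :=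
  ((h₁.continuous.comp continuous_coneChart_zero).integrable_of_hasCompactSupport
    (h₁.hasCompactSupport.comp_coneChart_left 0)).sub
  ((locallyIntegrable_of_bounded measurable_coneGrad abs_coneGrad_le_one).integrable_mul_test
    (h₂.continuous.comp continuous_coneChart_zero) (h₂.hasCompactSupport.comp_coneChart_left 0))

lemma srPerimeter_intrinsicSubgraph_coneFun_lt_top {U : Set Heis} (hU : Bornology.IsBounded U) :
    srPerimeter (intrinsicSubgraph univ coneFun) U < ∞ := by
  have hB : IsCompact ((fun w : (ℝ × ℝ) × ℝ => w.1) '' (coneChart.symm '' closure U)) :=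
    (hU.isCompact_closure.image coneChart.symm.continuous).image continuous_fst
  set B := (fun w : (ℝ × ℝ) × ℝ => w.1) '' (coneChart.symm '' closure U)
  have hB' : ∀ p, coneChart (p, 0) ∈ U → p ∈ B := fun p hp =>
    ⟨(p, 0), ⟨coneChart (p, 0), subset_closure hp, by simp⟩, rfl⟩
  refine lt_of_le_of_lt (b := ENNReal.ofReal (∫ p, B.indicator (fun _ => (2 : ℝ)) p)) ?_
    ENNReal.ofReal_lt_top
  refine iSup_le fun ψ₁ => iSup_le fun ψ₂ => iSup_le fun h₁ => iSup_le fun h₂ => iSup_le fun h =>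
    ENNReal.ofReal_le_ofReal ?_
  rw [setIntegral_intrinsicSubgraph_divergence h₁ h₂]
  refine integral_mono (integrable_boundary h₁ h₂) ?_ fun p => ?_
  · exact (integrable_indicator_iff hB.measurableSet).2
      (integrableOn_const hB.measure_lt_top.ne)
  · by_cases hp : coneChart (p, 0) ∈ U
    · rw [indicator_of_mem (hB' p hp)]
      exact (sub_mul_le_sqrt (h _) _).trans (sqrt_one_add_coneGrad_sq_le p)
    · have h1 := image_eq_zero_of_notMem_tsupport fun h => hp (h₁.tsupport_subset h)
      have h2 := image_eq_zero_of_notMem_tsupport fun h => hp (h₂.tsupport_subset h)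
      simp only [h1, h2, mul_zero, sub_zero]
      exact indicator_nonneg (fun _ _ => by norm_num) _

lemma heisX_congr {ψ ψ' : Heis → ℝ} {q : Heis} (h : ψ =ᶠ[𝓝 q] ψ') : heisX ψ q = heisX ψ' q := by
  rw [heisX, heisX, h.fderiv_eq]

lemma heisY_congr {ψ ψ' : Heis → ℝ} {q : Heis} (h : ψ =ᶠ[𝓝 q] ψ') : heisY ψ q = heisY ψ' q := by
  rw [heisY, heisY, h.fderiv_eq]

/-- If the horizontal unit normal of the intrinsic graph of `coneFun` extends to a horizontal
field on `U` that is smooth, divergence free and of length at most `1`, then the subgraph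
minimizes perimeter in `U`. -/
lemma isPerimeterMinimizer_of_calibration {U : Set Heis} (hU : IsOpen U) {a b : Heis → ℝ}
    (ha : ContDiffOn ℝ ((⊤ : ℕ∞) : WithTop ℕ∞) a U)
    (hb : ContDiffOn ℝ ((⊤ : ℕ∞) : WithTop ℕ∞) b U)
    (hab : ∀ q ∈ U, a q ^ 2 + b q ^ 2 ≤ 1) (hdiv : ∀ q ∈ U, heisX a q + heisY b q = 0)
    (hnormal : ∀ p, coneChart (p, 0) ∈ U →
      a (coneChart (p, 0)) - coneGrad p * b (coneChart (p, 0)) = √(1 + coneGrad p ^ 2)) :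
    IsPerimeterMinimizer (intrinsicSubgraph univ coneFun) U := by
  refine ⟨isClosed_intrinsicSubgraph_coneFun.measurableSet.nullMeasurableSet,
    fun F hF hK hKU => ?_⟩
  set G := intrinsicSubgraph univ coneFun with hG
  refine iSup_le fun ψ₁ => iSup_le fun ψ₂ => iSup_le fun h₁ => iSup_le fun h₂ => iSup_le fun h => ?_
  -- The cutoff must be `1` near the symmetric difference, so that the cut-off field stays
  -- divergence free there, and on the supports of `ψ₁` and `ψ₂`, so that its boundary term
  -- dominates theirs.
  obtain ⟨η, hη, hη01, hη1⟩ := exists_cutoff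
    ((hK.union h₁.hasCompactSupport.isCompact).union h₂.hasCompactSupport.isCompact) hU
    (union_subset (union_subset hKU h₁.tsupport_subset) h₂.tsupport_subset)
  have hηa := hη.mul_contDiffOn hU ha
  have hηb := hη.mul_contDiffOn hU hb
  have hzero : ∀ q ∈ (G \ F) ∪ (F \ G),
      heisX (fun q => η q * a q) q + heisY (fun q => η q * b q) q = 0 := by
    intro q hq
    have h1 := hη1 q (Or.inl (Or.inl (subset_closure hq)))
    have e1 : (fun q => η q * a q) =ᶠ[𝓝 q] a := by
      filter_upwards [h1] with q' hq'
      rw [hq', one_mul]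
    have e2 : (fun q => η q * b q) =ᶠ[𝓝 q] b := by
      filter_upwards [h1] with q' hq'
      rw [hq', one_mul]
    rw [heisX_congr e1, heisY_congr e2, hdiv q (hKU (subset_closure hq))]
  have hFG : ∫ q in F, (heisX (fun q => η q * a q) q + heisY (fun q => η q * b q) q) =
      ∫ q in G, (heisX (fun q => η q * a q) q + heisY (fun q => η q * b q) q) := by
    rw [← integral_indicator₀ hF,
      ← integral_indicator isClosed_intrinsicSubgraph_coneFun.measurableSet]
    congr 1 with q
    by_cases hqF : q ∈ F <;> by_cases hqG : q ∈ G
    · rw [indicator_of_mem hqF, indicator_of_mem hqG]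
    · rw [indicator_of_mem hqF, indicator_of_notMem hqG]
      exact hzero q (Or.inr ⟨hqF, hqG⟩)
    · rw [indicator_of_notMem hqF, indicator_of_mem hqG]
      exact (hzero q (Or.inl ⟨hqG, hqF⟩)).symm
    · rw [indicator_of_notMem hqF, indicator_of_notMem hqG]
  -- The cut-off calibration is an admissible pair for the perimeter of `F`; by `hFG` it has the
  -- same flux through `F` as through `G`.
  have hle : ENNReal.ofReal (∫ q in F, (heisX (fun q => η q * a q) q +
      heisY (fun q => η q * b q) q)) ≤ srPerimeter F U := by
    refine le_iSup_of_le (fun q => η q * a q) (le_iSup_of_le (fun q => η q * b q)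
      (le_iSup_of_le hηa (le_iSup_of_le hηb (le_iSup_of_le (fun q => ?_) le_rfl))))
    by_cases hq : q ∈ U
    · have h1 := hab q hq
      have h2 := (hη01 q).1
      have h3 := (hη01 q).2
      have h4 : η q ^ 2 ≤ 1 := pow_le_one₀ h2 h3
      nlinarith [mul_le_mul h4 h1 (by positivity) zero_le_one]
    · simp [image_eq_zero_of_notMem_tsupport fun h => hq (hη.tsupport_subset h)]
  refine le_trans (ENNReal.ofReal_le_ofReal ?_) hle
  rw [hFG, setIntegral_intrinsicSubgraph_divergence h₁ h₂,
    setIntegral_intrinsicSubgraph_divergence hηa hηb]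
  refine integral_mono (integrable_boundary h₁ h₂) (integrable_boundary hηa hηb) fun p => ?_
  have hr : η (coneChart (p, 0)) * a (coneChart (p, 0)) -
      coneGrad p * (η (coneChart (p, 0)) * b (coneChart (p, 0))) =
      η (coneChart (p, 0)) * √(1 + coneGrad p ^ 2) := by
    by_cases hp : coneChart (p, 0) ∈ U
    · rw [← hnormal p hp]
      ring
    · simp [image_eq_zero_of_notMem_tsupport fun h => hp (hη.tsupport_subset h)]
  simp only [hr]
  by_cases hp : coneChart (p, 0) ∈ tsupport ψ₁ ∪ tsupport ψ₂
  · have h1 : η (coneChart (p, 0)) = 1 :=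
      (hη1 _ (hp.elim (fun h => Or.inl (Or.inr h)) Or.inr)).self_of_nhds
    rw [h1, one_mul]
    exact sub_mul_le_sqrt (h _) _
  · have h1 := image_eq_zero_of_notMem_tsupport fun h => hp (Or.inl h)
    have h2 := image_eq_zero_of_notMem_tsupport fun h => hp (Or.inr h)
    rw [h1, h2]
    simp only [mul_zero, sub_zero]
    exact mul_nonneg (hη01 _).1 (Real.sqrt_nonneg _)

/-! ### Calibrating fields for the cone -/

lemma isPerimeterMinimizer_of_const {U : Set Heis} (hU : IsOpen U) {c d : ℝ}
    (hcd : c ^ 2 + d ^ 2 ≤ 1)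
    (hnormal : ∀ p, coneChart (p, 0) ∈ U → c - coneGrad p * d = √(1 + coneGrad p ^ 2)) :
    IsPerimeterMinimizer (intrinsicSubgraph univ coneFun) U :=
  isPerimeterMinimizer_of_calibration hU (a := fun _ => c) (b := fun _ => d) contDiffOn_const
    contDiffOn_const (fun _ _ => hcd) (fun _ _ => by simp [heisX, heisY]) hnormal

lemma contDiff_unitSlope : ContDiff ℝ ((⊤ : ℕ∞) : WithTop ℕ∞) unitSlope := by
  unfold unitSlope
  refine contDiff_id.div (ContDiff.sqrt (by fun_prop) fun s => by positivity) fun s => ?_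
  have := one_le_sqrt_one_add_sq s
  positivity

lemma contDiff_inv_sqrt_one_add_sq :
    ContDiff ℝ ((⊤ : ℕ∞) : WithTop ℕ∞) fun s : ℝ => (√(1 + s ^ 2))⁻¹ := by
  refine (ContDiff.sqrt (by fun_prop) fun s => by positivity).inv fun s => ?_
  have := one_le_sqrt_one_add_sq s
  positivity

lemma hasDerivAt_inv_sqrt_one_add_sq (s : ℝ) :
    HasDerivAt (fun s : ℝ => (√(1 + s ^ 2))⁻¹) (-(s * slopeDensity s)) s := by
  have h1 := one_le_sqrt_one_add_sq s
  refine ((hasDerivAt_sqrt_one_add_sq s).inv (by positivity)).congr_deriv ?_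
  rw [unitSlope, slopeDensity]
  field_simp

/-- The field is `(1, -s)/√(1+s²)` with `s = x/y`; on the graph `s = g`, so it is the unit normal.
Its divergence vanishes because `-s X(s) - Y(s) = -s/y + x/y² = 0`. Being smooth wherever `y ≠ 0`,
it handles all three pieces and their creases at once. -/
lemma isPerimeterMinimizer_off_vertical_plane {U : Set Heis} (hU : IsOpen U)
    (hy : ∀ q ∈ U, q.2.1 ≠ 0) : IsPerimeterMinimizer (intrinsicSubgraph univ coneFun) U := by
  have hs : ContDiffOn ℝ ((⊤ : ℕ∞) : WithTop ℕ∞) (fun q : Heis => q.1 / q.2.1) U :=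
    ContDiffOn.div (by fun_prop) (by fun_prop) hy
  have hsd : ∀ q ∈ U, HasFDerivAt (fun q : Heis => q.1 / q.2.1)
      (q.2.1⁻¹ • ContinuousLinearMap.fst ℝ ℝ (ℝ × ℝ) - (q.1 / q.2.1 ^ 2) •
        (ContinuousLinearMap.fst ℝ ℝ ℝ).comp (ContinuousLinearMap.snd ℝ ℝ (ℝ × ℝ))) q := by
    intro q hq
    have h1 : HasFDerivAt (fun q : Heis => q.2.1)
        ((ContinuousLinearMap.fst ℝ ℝ ℝ).comp (ContinuousLinearMap.snd ℝ ℝ (ℝ × ℝ))) q :=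
      hasFDerivAt_fst.comp q hasFDerivAt_snd
    have h2 := (hasDerivAt_inv (hy q hq)).comp_hasFDerivAt q h1
    refine ((hasFDerivAt_fst (𝕜 := ℝ) (p := q)).mul h2).congr_fderiv ?_
    ext <;> simp [div_eq_mul_inv]
  refine isPerimeterMinimizer_of_calibration hU
    (a := fun q => (√(1 + (q.1 / q.2.1) ^ 2))⁻¹) (b := fun q => -unitSlope (q.1 / q.2.1))
    (contDiff_inv_sqrt_one_add_sq.comp_contDiffOn hs)
    (contDiff_unitSlope.comp_contDiffOn hs).neg (fun q _ => ?_) (fun q hq => ?_) fun p hp => ?_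
  · generalize q.1 / q.2.1 = s
    have h1 := one_le_sqrt_one_add_sq s
    have h2 := sq_sqrt_one_add_sq s
    refine le_of_eq ?_
    rw [unitSlope, neg_sq, div_pow, inv_pow, h2]
    field_simp
  · have h1 := (hasDerivAt_inv_sqrt_one_add_sq (q.1 / q.2.1)).comp_hasFDerivAt q (hsd q hq)
    have h2 := ((hasDerivAt_unitSlope (q.1 / q.2.1)).comp_hasFDerivAt q (hsd q hq)).neg
    have e1 : heisX (fun q => (√(1 + (q.1 / q.2.1) ^ 2))⁻¹) q =
        -(q.1 / q.2.1 * slopeDensity (q.1 / q.2.1)) * q.2.1⁻¹ := by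
      rw [heisX]
      refine (DFunLike.congr_fun h1.fderiv _).trans ?_
      simp
    have e2 : heisY (fun q => -unitSlope (q.1 / q.2.1)) q =
        slopeDensity (q.1 / q.2.1) * (q.1 / q.2.1 ^ 2) := by
      rw [heisY]
      refine (DFunLike.congr_fun h2.fderiv _).trans ?_
      simp
    rw [e1, e2]
    have := hy q hq
    field_simp
    ring
  · have h0 : p.1 ≠ 0 := hy _ hp
    have hg : (coneChart (p, 0)).1 / (coneChart (p, 0)).2.1 = coneGrad p := by
      simp only [coneChart_apply, add_zero, coneFun_eq]
      field_simp
    simp only [hg]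
    have h1 := one_le_sqrt_one_add_sq (coneGrad p)
    have h2 := sq_sqrt_one_add_sq (coneGrad p)
    rw [unitSlope]
    field_simp
    linarith

lemma exists_isPerimeterMinimizer_of_isOpen {V : Set Heis} (hV : IsOpen V) {p : Heis}
    (hp : p ∈ V) (h : ∀ U ⊆ V, IsOpen U →
      IsPerimeterMinimizer (intrinsicSubgraph univ coneFun) U) :
    ∃ U : Set Heis, IsOpen U ∧ p ∈ U ∧
      srPerimeter (intrinsicSubgraph univ coneFun) U < ∞ ∧
      IsPerimeterMinimizer (intrinsicSubgraph univ coneFun) U :=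
  ⟨V ∩ Metric.ball p 1, hV.inter Metric.isOpen_ball, ⟨hp, Metric.mem_ball_self one_pos⟩,
    srPerimeter_intrinsicSubgraph_coneFun_lt_top
      (Metric.isBounded_ball.subset inter_subset_right),
    h _ inter_subset_left (hV.inter Metric.isOpen_ball)⟩

lemma exists_isPerimeterMinimizer_coneFun {p : Heis} (hp : p ∈ intrinsicGraph univ coneFun)
    (hp0 : p ≠ 0) : ∃ U : Set Heis, IsOpen U ∧ p ∈ U ∧
      srPerimeter (intrinsicSubgraph univ coneFun) U < ∞ ∧
      IsPerimeterMinimizer (intrinsicSubgraph univ coneFun) U := by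
  -- On the graph `y = 0` forces `x = 0`, hence `z ≠ 0`. In a neighbourhood where `t < 0`,
  -- respectively `t > y²/2`, `g` is constantly `0`, respectively `1`, and the normal is constant.
  by_cases hy : p.2.1 = 0
  · rw [mem_intrinsicGraph_iff] at hp
    have hx : p.1 = 0 := by rw [hp, coneFun_eq]; simp [hy]
    have hz : p.2.2 ≠ 0 := fun hz => hp0 (Prod.ext hx (Prod.ext hy hz))
    rcases lt_or_gt_of_ne hz with hz | hz
    · refine exists_isPerimeterMinimizer_of_isOpen
        (V := {q : Heis | q.2.2 + q.1 * q.2.1 / 2 < 0})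
        (isOpen_lt (by fun_prop) continuous_const) (by simpa [hx] using hz) fun U hUV hU =>
        isPerimeterMinimizer_of_const hU (c := 1) (d := 0) (by norm_num) fun p' hp' => ?_
      have h1 : p'.2 < 0 := by simpa [coneChart_apply] using hUV hp'
      simp [coneGrad_of_nonpos h1.le]
    · refine exists_isPerimeterMinimizer_of_isOpen
        (V := {q : Heis | q.2.1 ^ 2 / 2 < q.2.2 + q.1 * q.2.1 / 2})
        (isOpen_lt (by fun_prop) (by fun_prop)) (by simpa [hx, hy] using hz) fun U hUV hU =>
        isPerimeterMinimizer_of_const hU (c := (√2)⁻¹) (d := -(√2)⁻¹) ?_ fun p' hp' => ?_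
      · rw [neg_sq, inv_pow, Real.sq_sqrt (by norm_num)]
        norm_num
      · have h1 : p'.1 ^ 2 / 2 < p'.2 := by simpa [coneChart_apply] using hUV hp'
        rw [coneGrad_of_gt h1]
        have h2 : √(2 : ℝ) ^ 2 = 2 := Real.sq_sqrt (by norm_num)
        have h3 : √(2 : ℝ) ≠ 0 := by positivity
        norm_num
        field_simp
        linarith
  · exact exists_isPerimeterMinimizer_of_isOpen (V := {q : Heis | q.2.1 ≠ 0})
      (isOpen_ne_fun (by fun_prop) continuous_const) hy fun U hUV hU =>
      isPerimeterMinimizer_off_vertical_plane hU fun q hq => hUV hq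

theorem theorem1p3 :
    -- regularity of `f`
    (Continuous coneFun ∧
      (∀ p : ℝ≥0∞, 1 ≤ p → p < 3 → MemW1pLoc univ p coneFun) ∧
      LocallyLipschitzOn {(0 : ℝ × ℝ)}ᶜ coneFun) ∧
    -- the intrinsic gradient is bounded, and continuous away from the origin
    ((∃ g : ℝ × ℝ → ℝ, ContinuousOn g {(0 : ℝ × ℝ)}ᶜ ∧
        intrinsicGradient univ coneFun =ᵐ[volume] g) ∧
      MemLp (intrinsicGradient univ coneFun) ∞ volume) ∧
    -- `f` is stable, but its graph is not an intrinsic plane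
    (IsStableGraph univ coneFun ∧ ¬ IsIntrinsicPlane (intrinsicGraph univ coneFun)) ∧
    -- the graph, which is a cone
    (intrinsicGraph univ coneFun =
        {q : Heis | q.1 = 0 ∧ q.2.2 ≤ 0} ∪
        ({q : Heis | 0 ≤ q.1 ∧ q.1 ≤ q.2.1 ∧ q.2.2 = 0} ∪
          {q : Heis | q.2.1 ≤ q.1 ∧ q.1 ≤ 0 ∧ q.2.2 = 0}) ∪
        {q : Heis | q.1 = q.2.1 ∧ 0 ≤ q.2.2} ∧
      ∀ l : ℝ, 0 < l →
        heisDilation l '' intrinsicGraph univ coneFun = intrinsicGraph univ coneFun) ∧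
    -- away from the origin the graph is locally area minimizing
    (∀ p ∈ intrinsicGraph univ coneFun, p ≠ 0 →
      ∃ U : Set Heis, IsOpen U ∧ p ∈ U ∧
        srPerimeter (intrinsicSubgraph univ coneFun) U < ∞ ∧
        IsPerimeterMinimizer (intrinsicSubgraph univ coneFun) U) := by
  refine ⟨⟨continuous_coneFun, fun p hp hp' => memW1pLoc_coneFun hp hp', locallyLipschitzOn_coneFun⟩,
    ⟨⟨coneGrad, continuousOn_coneGrad, intrinsicGradient_coneFun_ae_eq⟩,
      memLp_top_intrinsicGradient_coneFun⟩,
    ⟨isStableGraph_coneFun, not_isIntrinsicPlane_coneFun⟩,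
    ⟨intrinsicGraph_coneFun, fun l hl => heisDilation_image_intrinsicGraph_coneFun hl⟩,
    fun p hp hp0 => exists_isPerimeterMinimizer_coneFun hp hp0⟩
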